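/- Conventions. $\hbar=1$. A kernel $\rho(x,r)=\langle r-\tfrac x2|\hat\rho|r+\tfrac x2\rangle$ represents an operator in the difference/sum coordinates. An \emph{initial state} is a Schwartz function $\rho(x,r)$ on $\mathbb R^2$ which is the kernel of a density operator (positive, trace one). Let $$\Sigma=i\big(b_1x_fr_f+b_2x_fr_i+b_3x_ir_f+b_4x_ir_i+c_1x_f+c_2x_i\big)-a_1x_f^2-a_2x_fx_i-a_3x_i^2-e_1r_f^2-e_2r_fr_i-e_3r_i^2-d_1r_f-d_2r_i$$ with real coefficients, and consider the operations $\rho_f(x_f,r_f)=\int J\,\rho_i(x_i,r_i)\,dx_i\,dr_i$ with $$J_{I}=|\beta|\sqrt{e_1/\pi}\;\delta(\alpha x_f-\beta x_i)\,e^{\Sigma},\qquad \beta\ne0,\ e_1>0,\ e_3=\tfrac{e_2^2}{4e_1},\ d_1=d_2=0,$$ $$J_{II}=|\beta\gamma|\;\delta(\gamma r_f-\eta r_i)\,\delta(\alpha x_f-\beta x_i)\,e^{\Sigma},\qquad \beta,\gamma\neq0,\ e_1(\tfrac\eta\gamma)^2+e_2\tfrac\eta\gamma+e_3=0,\ d_1\tfrac\eta\gamma+d_2=0$$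 (the trace preserving ones). $J_I$ is non-singular if $\alpha e_2\neq0$, and $J_{II}$ is non-singular if $\alpha\eta\ne0$. Let $S\subset\mathbb R$ be a nondegenerate interval, and let all coefficients ($a_n,b_n,c_n,d_n,e_n,\alpha,\beta$, and $\gamma,\eta$ for $J_{II}$) be differentiable functions of $t\in S$ such that $J_I(t)$ (resp. $J_{II}(t)$) is trace preserving and non-singular for every $t\in S$. Let $\rho(x,r;t)$ be the image of an initial state $\rho$ under $J_I(t)$ (resp. $J_{II}(t)$). A \emph{master equation exists} if there are $\mathcal L_c(t)\in\mathbb C$ and complex $2\times2$ matrices $\mathbf X(t),\mathbf Y(t),\mathbf Z(t)$ such that, with $$\mathcal L_t=\mathcal L_c+(\partial_x,\partial_r)\mathbf X\binom{\partial_x}{\partial_r}+(x,r)\mathbf Y\binom{\partial_x}{\partial_r}+(x,r)\mathbf Z\binom{x}{r},$$ one has $\partial_t\rho(x,r;t)=\mathcal L_t[\rho(x,r;t)]$ for every initial state, every $t\in S$ and all $x,r$. Put $A=\alpha/\beta$, $B=\gamma/\eta$ and $c=c_1+Ac_2$. (1) For $J_I$, and likewise for $J_{II}$, a master equation exists if and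 only if $c\propto A$, i.e. there is a constant $k\in\mathbb R$ with $c(t)=kA(t)$ for all $t\in S$. (2) In that case, if $\mathbf X$ and $\mathbf Z$ are taken symmetric, the generator is unique and is given as follows. For $J_I$, with $\lambda_1=b_1+Ab_3$, $\lambda_2=b_2+Ab_4$, $\lambda_3=a_1+Aa_2+A^2a_3$: $X_{xx}=X_{xr}=Y_{rx}=Z_{rr}=0$ and $$Y_{xx}=\frac{\dot A}{A},\quad \mathcal L_c=Y_{rr}=\frac{\dot e_1}{e_1}-\frac{\dot e_2}{e_2},\quad X_{rr}=\frac{\dot e_1}{4e_1^2}-\frac{\dot e_2}{2e_1e_2},$$ $$Y_{xr}=i\Big(\frac{\lambda_1\dot e_2}{e_1e_2}+\frac{\lambda_2\dot A}{e_2A}-\frac{\lambda_1\dot e_1}{2e_1^2}-\frac{\dot\lambda_2}{e_2}\Big),$$ $$Z_{xx}=\frac{\lambda_1^2}{2}\Big(\frac{\dot e_2}{e_1e_2}-\frac{\dot e_1}{2e_1^2}\Big)+\frac{\lambda_1}{e_2}\Big(\frac{\lambda_2\dot A}{A}-\dot\lambda_2\Big)+2\lambda_3\frac{\dot A}{A}-\dot\lambda_3,$$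 $$Z_{xr}=i\Big(\frac{\dot A}{A}\Big(\frac{e_1\lambda_2}{e_2}-\frac{\lambda_1}{2}\Big)+\frac{\dot\lambda_1}{2}-\frac{\dot\lambda_2e_1}{e_2}+\frac{\lambda_1}{2}\Big(\frac{\dot e_2}{e_2}-\frac{\dot e_1}{e_1}\Big)\Big).$$ For $J_{II}$, with $\lambda=b_1+Ab_3+B(b_2+Ab_4)$: $X_{xx}=X_{xr}=X_{rr}=Z_{rr}=Y_{rx}=Y_{xr}=0$ and $$Y_{xx}=\frac{\dot A}{A},\quad \mathcal L_c=Y_{rr}=\frac{\dot B}{B},\quad Z_{xx}=a_2\dot A+\frac{2a_1\dot A}{A}-A^2\dot a_3-A\dot a_2-\dot a_1,\quad Z_{xr}=i\Big(\frac{\dot\lambda}{2}-\frac{\lambda}{2}\Big(\frac{\dot A}{A}+\frac{\dot B}{B}\Big)\Big).$$ (3) Singular channels admit no master equation: a one-mode Gaussian channel $(\mathbf T,\mathbf N,\vec\tau)$, acting by $\sigma\mapsto\mathbf T\sigma\mathbf T^{\mathsf T}+\mathbf N$, $\vec d\mapsto\mathbf T\vec d+\vec\tau$ (on characteristic functions: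 $\chi_f(k)=\chi(\mathbf T^{\mathsf T}k)\,e^{i\vec\tau\cdot k-\frac12k^{\mathsf T}\mathbf Nk}$), is singular if it is completely positive and $\det\mathbf T=0$. Let $(\Phi_t)_{0<t<t_1}$ be any family of singular one-mode Gaussian channels, or any family of trace preserving operations of the form $J_I$ with $\alpha(t)e_2(t)=0$ for all $t$. Then there are no maps $\mathcal L_t$ ($0<t<t_1$) on kernels whatsoever such that, for every initial state $\rho$, $\rho(x,r;t)=\Phi_t[\rho](x,r)$ solves $\partial_t\rho=\mathcal L_t[\rho]$ on $(0,t_1)$ with initial condition $\rho(x,r;t)\to\rho(x,r)$ as $t\to0^+$. -/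

import Mathlib

open MeasureTheory Set Filter Topology
open scoped SchwartzMap ComplexOrder ComplexConjugate

noncomputable section

namespace GaussChannel

/-- A position-space kernel `ρ x r = ⟨r - x/2| ρ̂ |r + x/2⟩` in the difference coordinate `x` and the
sum coordinate `r`. -/
abbrev Kernel : Type := ℝ → ℝ → ℂ

/-- `ρ` is the kernel (in difference and sum coordinates) of a density operator on `L²(ℝ)`:
`⟨φ, ρ̂ φ⟩ ≥ 0` and `Tr ρ̂ = 1`, where `⟨q₁|ρ̂|q₂⟩ = ρ (q₂ - q₁, (q₁ + q₂)/2)`. -/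
def IsState (ρ : 𝓢(ℝ × ℝ, ℂ)) : Prop :=
  (∀ φ : 𝓢(ℝ, ℂ),
      0 ≤ ∫ q₁ : ℝ, ∫ q₂ : ℝ, conj (φ q₁) * ρ (q₂ - q₁, (q₁ + q₂) / 2) * φ q₂) ∧
    ∫ r : ℝ, ρ (0, r) = 1

/-! ### The functional forms -/

/-- The (real) coefficients of the quadratic exponent. -/
structure Exponent where
  (a₁ a₂ a₃ b₁ b₂ b₃ b₄ c₁ c₂ d₁ d₂ e₁ e₂ e₃ : ℝ)

/-- The quadratic exponent `Σ(x_f, x_i; r_f, r_i)`. -/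
def Exponent.eval (p : Exponent) (xf xi rf ri : ℝ) : ℂ :=
  Complex.I * ((p.b₁ * xf * rf + p.b₂ * xf * ri + p.b₃ * xi * rf + p.b₄ * xi * ri
      + p.c₁ * xf + p.c₂ * xi : ℝ) : ℂ)
    - ((p.a₁ * xf ^ 2 + p.a₂ * xf * xi + p.a₃ * xi ^ 2
      + p.e₁ * rf ^ 2 + p.e₂ * rf * ri + p.e₃ * ri ^ 2 + p.d₁ * rf + p.d₂ * ri : ℝ) : ℂ)

/-- Parameters of `J_I = N_I δ(α x_f - β x_i) exp Σ`. -/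
structure FormI extends Exponent where
  (α β : ℝ)

/-- Parameters of `J_II = N_II δ(γ r_f - η r_i) δ(α x_f - β x_i) exp Σ`. -/
structure FormII extends Exponent where
  (α β γ η : ℝ)

/-- The trace-preservation conditions for `J_I`. -/
def FormI.TracePreserving (J : FormI) : Prop :=
  J.β ≠ 0 ∧ 0 < J.e₁ ∧ J.e₂ ^ 2 / (4 * J.e₁) - J.e₃ = 0 ∧ J.d₁ = 0 ∧ J.d₂ = 0

/-- The trace-preservation conditions for `J_II`. -/
def FormII.TracePreserving (J : FormII) : Prop :=
  J.β ≠ 0 ∧ J.γ ≠ 0 ∧ J.e₁ * (J.η / J.γ) ^ 2 + J.e₂ * (J.η / J.γ) + J.e₃ = 0 ∧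
    J.d₁ * (J.η / J.γ) + J.d₂ = 0

/-- The normalization `N_I = |β| √(e₁/π)`. -/
def FormI.norm (J : FormI) : ℝ := |J.β| * √(J.e₁ / Real.pi)

/-- The normalization `N_II = |β γ|`. -/
def FormII.norm (J : FormII) : ℝ := |J.β * J.γ|

/-- The action `ρ_f(x, r) = ∫∫ J_I(x, r; x', r') ρ(x', r') dx' dr'`. The delta factor acts by
`∫ δ(α x - β x') g(x') dx' = g(α x / β) / |β|`. -/
def FormI.act (J : FormI) (ρ : 𝓢(ℝ × ℝ, ℂ)) : Kernel := fun x r =>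
  (J.norm : ℂ) * ((1 / |J.β| : ℝ) : ℂ) *
    ∫ r' : ℝ, Complex.exp (J.toExponent.eval x (J.α * x / J.β) r r') * ρ (J.α * x / J.β, r')

/-- The action `ρ_f(x, r) = ∫∫ J_II(x, r; x', r') ρ(x', r') dx' dr'`, with both delta factors
evaluated. -/
def FormII.act (J : FormII) (ρ : 𝓢(ℝ × ℝ, ℂ)) : Kernel := fun x r =>
  (J.norm : ℂ) * ((1 / (|J.β| * |J.η|) : ℝ) : ℂ) *
    (Complex.exp (J.toExponent.eval x (J.α * x / J.β) r (J.γ * r / J.η)) *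
      ρ (J.α * x / J.β, J.γ * r / J.η))

/-- All exponent coefficients are differentiable functions of time on `S`. -/
def Exponent.DifferentiableFamily (p : ℝ → Exponent) (S : Set ℝ) : Prop :=
  ∀ f ∈ [Exponent.a₁, Exponent.a₂, Exponent.a₃, Exponent.b₁, Exponent.b₂, Exponent.b₃,
      Exponent.b₄, Exponent.c₁, Exponent.c₂, Exponent.d₁, Exponent.d₂, Exponent.e₁,
      Exponent.e₂, Exponent.e₃], DifferentiableOn ℝ (fun t => f (p t)) S

/-- A time-dependent `J_I`: differentiable coefficients, trace preserving and non-singular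
(`α e₂ ≠ 0`) at all times in `S`. -/
structure FormI.NonsingularFamily (J : ℝ → FormI) (S : Set ℝ) : Prop where
  exponent : Exponent.DifferentiableFamily (fun t => (J t).toExponent) S
  alpha : DifferentiableOn ℝ (fun t => (J t).α) S
  beta : DifferentiableOn ℝ (fun t => (J t).β) S
  tracePreserving : ∀ t ∈ S, (J t).TracePreserving
  nonsingular : ∀ t ∈ S, (J t).α * (J t).e₂ ≠ 0

/-- A time-dependent `J_II`: differentiable coefficients, trace preserving and non-singular
(`α η ≠ 0`) at all times in `S`. -/
structure FormII.NonsingularFamily (J : ℝ → FormII) (S : Set ℝ) : Prop where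
  exponent : Exponent.DifferentiableFamily (fun t => (J t).toExponent) S
  alpha : DifferentiableOn ℝ (fun t => (J t).α) S
  beta : DifferentiableOn ℝ (fun t => (J t).β) S
  gamma : DifferentiableOn ℝ (fun t => (J t).γ) S
  eta : DifferentiableOn ℝ (fun t => (J t).η) S
  tracePreserving : ∀ t ∈ S, (J t).TracePreserving
  nonsingular : ∀ t ∈ S, (J t).α * (J t).η ≠ 0

/-- `A = α / β`. -/
def FormI.A (J : FormI) : ℝ := J.α / J.β
/-- `A = α / β`. -/
def FormII.A (J : FormII) : ℝ := J.α / J.β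
/-- `B = γ / η`. -/
def FormII.B (J : FormII) : ℝ := J.γ / J.η

/-- `c = c₁ + A c₂`. -/
def FormI.c (J : FormI) : ℝ := J.c₁ + J.A * J.c₂
/-- `c = c₁ + A c₂`. -/
def FormII.c (J : FormII) : ℝ := J.c₁ + J.A * J.c₂

/-- `λ₁ = b₁ + A b₃`. -/
def FormI.l₁ (J : FormI) : ℝ := J.b₁ + J.A * J.b₃
/-- `λ₂ = b₂ + A b₄`. -/
def FormI.l₂ (J : FormI) : ℝ := J.b₂ + J.A * J.b₄
/-- `λ₃ = a₁ + A a₂ + A² a₃`. -/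
def FormI.l₃ (J : FormI) : ℝ := J.a₁ + J.A * J.a₂ + J.A ^ 2 * J.a₃
/-- `λ = b₁ + A b₃ + B (b₂ + A b₄)`. -/
def FormII.l (J : FormII) : ℝ := J.b₁ + J.A * J.b₃ + J.B * (J.b₂ + J.A * J.b₄)

/-! ### Quadratic generators and master equations -/

/-- Coefficients of an operator quadratic in `x, r, ∂_x, ∂_r`; index `0` is `x`, index `1` is
`r`. -/
@[ext]
structure QuadGenerator where
  Lc : ℂ
  X : Matrix (Fin 2) (Fin 2) ℂ
  Y : Matrix (Fin 2) (Fin 2) ℂ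
  Z : Matrix (Fin 2) (Fin 2) ℂ

/-- Partial derivatives: `pd 0 = ∂_x`, `pd 1 = ∂_r`. -/
def pd : Fin 2 → Kernel → Kernel :=
  ![fun f x r => deriv (fun y => f y r) x, fun f x r => deriv (fun s => f x s) r]

/-- `L_c + (∂_x,∂_r) X (∂_x,∂_r)ᵀ + (x,r) Y (∂_x,∂_r)ᵀ + (x,r) Z (x,r)ᵀ` applied to a kernel. -/
def QuadGenerator.act (g : QuadGenerator) (f : Kernel) : Kernel := fun x r =>
  let v : Fin 2 → ℂ := ![(x : ℂ), (r : ℂ)]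
  g.Lc * f x r
    + ∑ i, ∑ j, g.X i j * pd i (pd j f) x r
    + ∑ i, ∑ j, v i * g.Y i j * pd j f x r
    + ∑ i, ∑ j, v i * g.Z i j * v j * f x r

/-- `∂_t ρ(x, r; t) = L_t[ρ(t)](x, r)` at all times in `S`, for `ρ(t) = Φ_t[ρ]` and every
initial state `ρ`. -/
def MasterEquation (S : Set ℝ) (Φ : ℝ → 𝓢(ℝ × ℝ, ℂ) → Kernel) (L : ℝ → Kernel → Kernel) : Prop :=
  ∀ ρ : 𝓢(ℝ × ℝ, ℂ), IsState ρ → ∀ t ∈ S, ∀ x r : ℝ,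
    HasDerivWithinAt (fun s => Φ s ρ x r) (L t (Φ t ρ) x r) S t

/-- The evolution `Φ` starts from the identity: `ρ(x, r; t) → ρ(x, r)` as `t → 0⁺`, for every
initial state `ρ`. -/
def StartsFromIdentity (Φ : ℝ → 𝓢(ℝ × ℝ, ℂ) → Kernel) : Prop :=
  ∀ ρ : 𝓢(ℝ × ℝ, ℂ), IsState ρ → ∀ x r : ℝ,
    Tendsto (fun t => Φ t ρ x r) (𝓝[>] 0) (𝓝 (ρ (x, r)))

/-- The explicit generator for `J_I` at time `t`. -/
def FormI.generator (S : Set ℝ) (J : ℝ → FormI) (t : ℝ) : QuadGenerator :=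
  let A := (J t).A
  let e₁ := (J t).e₁
  let e₂ := (J t).e₂
  let l₁ := (J t).l₁
  let l₂ := (J t).l₂
  let l₃ := (J t).l₃
  let dA := derivWithin (fun s => (J s).A) S t
  let de₁ := derivWithin (fun s => (J s).e₁) S t
  let de₂ := derivWithin (fun s => (J s).e₂) S t
  let dl₁ := derivWithin (fun s => (J s).l₁) S t
  let dl₂ := derivWithin (fun s => (J s).l₂) S t
  let dl₃ := derivWithin (fun s => (J s).l₃) S t
  let Xrr : ℝ := de₁ / (4 * e₁ ^ 2) - de₂ / (2 * e₁ * e₂)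
  let Yxx : ℝ := dA / A
  let Yrr : ℝ := de₁ / e₁ - de₂ / e₂
  let Yxr : ℝ := l₁ * de₂ / (e₁ * e₂) + l₂ * dA / (e₂ * A) - l₁ * de₁ / (2 * e₁ ^ 2) - dl₂ / e₂
  let Zxx : ℝ := l₁ ^ 2 / 2 * (de₂ / (e₁ * e₂) - de₁ / (2 * e₁ ^ 2))
    + l₁ / e₂ * (l₂ * dA / A - dl₂) + 2 * l₃ * dA / A - dl₃
  let Zxr : ℝ := dA / A * (e₁ * l₂ / e₂ - l₁ / 2) + dl₁ / 2 - dl₂ * e₁ / e₂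
    + l₁ / 2 * (de₂ / e₂ - de₁ / e₁)
  { Lc := (Yrr : ℂ)
    X := !![0, 0; 0, (Xrr : ℂ)]
    Y := !![(Yxx : ℂ), Complex.I * (Yxr : ℂ); 0, (Yrr : ℂ)]
    Z := !![(Zxx : ℂ), Complex.I * (Zxr : ℂ); Complex.I * (Zxr : ℂ), 0] }

/-- The explicit generator for `J_II` at time `t`. -/
def FormII.generator (S : Set ℝ) (J : ℝ → FormII) (t : ℝ) : QuadGenerator :=
  let A := (J t).A
  let B := (J t).B
  let l := (J t).l
  let dA := derivWithin (fun s => (J s).A) S t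
  let dB := derivWithin (fun s => (J s).B) S t
  let dl := derivWithin (fun s => (J s).l) S t
  let da₁ := derivWithin (fun s => (J s).a₁) S t
  let da₂ := derivWithin (fun s => (J s).a₂) S t
  let da₃ := derivWithin (fun s => (J s).a₃) S t
  let Yxx : ℝ := dA / A
  let Yrr : ℝ := dB / B
  let Zxx : ℝ := (J t).a₂ * dA + 2 * (J t).a₁ * dA / A - A ^ 2 * da₃ - A * da₂ - da₁
  let Zxr : ℝ := 1 / 2 * dl - l / 2 * (dA / A + dB / B)
  { Lc := (Yrr : ℂ)
    X := 0
    Y := !![(Yxx : ℂ), 0; 0, (Yrr : ℂ)]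
    Z := !![(Zxx : ℂ), Complex.I * (Zxr : ℂ); Complex.I * (Zxr : ℂ), 0] }

/-! ### General one-mode Gaussian channels -/

/-- The characteristic function `χ(u, v) = Tr(ρ̂ exp(i(u q̂ + v p̂)))` of `ρ`, with `ħ = 1`. -/
def charFun (ρ : 𝓢(ℝ × ℝ, ℂ)) (k : Fin 2 → ℝ) : ℂ :=
  ∫ r : ℝ, Complex.exp (Complex.I * ((k 0 * r : ℝ) : ℂ)) * ρ (-(k 1), r)

/-- The tuple `(T, N, τ)` of a one-mode Gaussian operation, acting by
`σ ↦ T σ Tᵀ + N`, `d ↦ T d + τ` on covariance matrices and mean vectors. -/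
structure GaussianTuple where
  T : Matrix (Fin 2) (Fin 2) ℝ
  N : Matrix (Fin 2) (Fin 2) ℝ
  τ : Fin 2 → ℝ

/-- The characteristic function of the output:
`χ_f(k) = χ(Tᵀ k) exp(i τ·k - k·(N k)/2)`. -/
def GaussianTuple.outChar (G : GaussianTuple) (ρ : 𝓢(ℝ × ℝ, ℂ)) (k : Fin 2 → ℝ) : ℂ :=
  charFun ρ (G.T.transpose.mulVec k) *
    Complex.exp (Complex.I * ((G.τ ⬝ᵥ k : ℝ) : ℂ) - ((k ⬝ᵥ G.N.mulVec k / 2 : ℝ) : ℂ))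

/-- The output kernel, recovered from its characteristic function by Fourier inversion. -/
def GaussianTuple.act (G : GaussianTuple) (ρ : 𝓢(ℝ × ℝ, ℂ)) : Kernel := fun x r =>
  ((1 / (2 * Real.pi) : ℝ) : ℂ) *
    ∫ u : ℝ, Complex.exp (-(Complex.I * ((u * r : ℝ) : ℂ))) * G.outChar ρ ![u, -x]

/-- The symplectic matrix. -/
def symp : Matrix (Fin 2) (Fin 2) ℝ := !![0, 1; -1, 0]

/-- Complete positivity (for `ħ = 1`): `N + (i/2) Ω - (i/2) T Ω Tᵀ ≥ 0`. -/
def GaussianTuple.CompletelyPositive (G : GaussianTuple) : Prop :=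
  (G.N.map (fun a : ℝ => (a : ℂ))
    + (Complex.I / 2) • (symp - G.T * symp * G.T.transpose).map (fun a : ℝ => (a : ℂ))).PosSemidef

/-- A singular one-mode Gaussian channel: completely positive, with `T` not invertible. -/
def GaussianTuple.IsSingularChannel (G : GaussianTuple) : Prop :=
  G.CompletelyPositive ∧ G.T.det = 0

end GaussChannel

end

/-!
Both forms of the operation act explicitly. After the delta factors are evaluated, `J_II` multiplies
`ρ(A x, B r)` by a Gaussian factor, and `J_I` sends `ρ` to a Gaussian factor times the moment
`∫ exp (z r' - m r'²) ρ(A x, r') dr'` with `z = i λ₂ x - e₂ r`, `m = e₂² / (4 e₁)`. Differentiation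
under the integral sign (`hasDerivWithinAt_gaussMoment`) expresses all derivatives in `t`, `x`, `r`
through a few such moments, and comparing their coefficients gives, for every Schwartz `ρ`,

  `∂_t ρ = L ρ + i (c' - c A' / A) x ρ`,

where `L` is the explicit generator (`FormI.hasDerivWithinAt_act`, `FormII.hasDerivWithinAt_act`).
The second term is all that stands in the way of a master equation, and it vanishes on an interval
if and only if `c / A` is constant there (`exists_eq_mul_iff`).

It cannot be absorbed into another quadratic generator. The images of the coherent states with mean
`(q, p)` are Gaussian kernels `exp h` with `h` quadratic; a quadratic generator multiplies such a
kernel by a polynomial in `x`, `r`, `∂_x h`, `∂_r h`, and at each `(x, r)` the pair `(∂_x h, ∂_r h)`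
runs over a real plane spanning `ℂ²` as `p, q` vary. So a master equation fixes all coefficients
up to the antisymmetric parts of `X` and `Z`, and forces the extra term to vanish
(`QuadGenerator.eq_of_symbol_eq`, `MasterEquation.eq_generator`).

Families of singular channels never start from the identity, whatever equation they satisfy. If
`det T = 0`, then complete positivity says that the noise `N` alone obeys the uncertainty relation
`N₀₀ N₁₁ - N₀₁² ≥ 1/4`. For an input of position variance `1/4` the output position variance, which
is at least `N₀₀`, must tend to `1/4`; for an input with variances `1/2` the Schur complement of the
output covariance, which is at least `1 / (4 N₀₀)`, must tend to `1/2`; these limits are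
incompatible. For singular operations `J_I`, either the output depends only on the position density
of the input, or the output density does not depend on the input at all.
-/

noncomputable section

namespace GaussChannel

/-! ### Gaussian states -/

theorem norm_iteratedFDeriv_cexp_le (n : ℕ) (w : ℂ) :
    ‖iteratedFDeriv ℝ n Complex.exp w‖ ≤ ‖Complex.exp w‖ := by
  induction n generalizing w with
  | zero => simp
  | succ n ih =>
    have hfd : fderiv ℝ Complex.exp = (ContinuousLinearMap.mul ℝ ℂ) ∘ Complex.exp := by
      ext z
      have h := ((Complex.hasDerivAt_exp z).hasFDerivAt.restrictScalars ℝ).fderiv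
      rw [h]
      simp [mul_comm]
    have hc : ContDiff ℝ n Complex.exp := Complex.contDiff_exp
    rw [← norm_iteratedFDeriv_fderiv, hfd]
    refine ((ContinuousLinearMap.mul ℝ ℂ).norm_iteratedFDeriv_comp_left
      hc.contDiffAt le_rfl).trans ?_
    calc _ ≤ 1 * ‖iteratedFDeriv ℝ n Complex.exp w‖ := by
          gcongr
          exact ContinuousLinearMap.opNorm_mul_le ℝ ℂ
      _ ≤ _ := by simpa using ih w

/-- By Faà di Bruno's formula the derivatives of `exp ∘ f` are at most `|exp ∘ f|` times a power
of `1 + ‖x‖`, so only the decay of `exp ∘ f` itself has to be checked. -/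
theorem exists_schwartzMap_cexp {E : Type*} [NormedAddCommGroup E] [NormedSpace ℝ E] {f : E → ℂ}
    (hf : f.HasTemperateGrowth)
    (hdecay : ∀ k : ℕ, ∃ C : ℝ, ∀ x, (1 + ‖x‖) ^ k * ‖Complex.exp (f x)‖ ≤ C) :
    ∃ φ : 𝓢(E, ℂ), ∀ x, φ x = Complex.exp (f x) := by
  refine ⟨⟨fun x => Complex.exp (f x), Complex.contDiff_exp.comp hf.1, fun k n => ?_⟩,
    fun x => rfl⟩
  obtain ⟨l, C, hC, hgrowth⟩ := hf.norm_iteratedFDeriv_le_uniform n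
  obtain ⟨M, hM⟩ := hdecay (k + l * n)
  refine ⟨(n.factorial : ℝ) * (C + 1) ^ n * M, fun x => ?_⟩
  have hD (N : ℕ) (hN₁ : 1 ≤ N) (hN₂ : N ≤ n) :
      ‖iteratedFDeriv ℝ N f x‖ ≤ ((C + 1) * (1 + ‖x‖) ^ l) ^ N := by
    refine (hgrowth N hN₂ x).trans ?_
    rw [mul_pow]
    have hN₁' := (lt_of_lt_of_le zero_lt_one hN₁).ne'
    gcongr
    · exact le_trans (by simp) (le_self_pow₀ (by simp [hC]) hN₁')
    · exact le_self_pow₀ (one_le_pow₀ (by simp)) hN₁'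
  have hmain := norm_iteratedFDeriv_comp_le (𝕜 := ℝ) (g := Complex.exp) (f := f) (n := n) (N := n)
    Complex.contDiff_exp (hf.1.of_le (by exact_mod_cast le_top)) le_rfl x
    (fun i _ => norm_iteratedFDeriv_cexp_le i (f x)) hD
  have hx : ‖x‖ ^ k ≤ (1 + ‖x‖) ^ k := by
    gcongr
    linarith
  calc ‖x‖ ^ k * ‖iteratedFDeriv ℝ n (fun x => Complex.exp (f x)) x‖
      ≤ (1 + ‖x‖) ^ k *
          (n.factorial * ‖Complex.exp (f x)‖ * ((C + 1) * (1 + ‖x‖) ^ l) ^ n) :=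
        mul_le_mul hx hmain (norm_nonneg _) (by positivity)
    _ = (n.factorial : ℝ) * (C + 1) ^ n * ((1 + ‖x‖) ^ (k + l * n) * ‖Complex.exp (f x)‖) := by
        rw [mul_pow, pow_add, pow_mul]
        ring
    _ ≤ _ := by
        gcongr
        exact hM x

theorem exists_schwartzMap_gaussian {σ : ℝ} (hσ : 0 < σ) (p q : ℝ) :
    ∃ φ : 𝓢(ℝ × ℝ, ℂ), ∀ x : ℝ × ℝ, φ x =
      Complex.exp (-σ * (x.2 - q) ^ 2 - σ / 4 * x.1 ^ 2 - Complex.I * p * x.1) := by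
  refine exists_schwartzMap_cexp (f := fun x : ℝ × ℝ =>
    -σ * ((x.2 : ℂ) - q) ^ 2 - σ / 4 * (x.1 : ℂ) ^ 2 - Complex.I * p * x.1) ?_ ?_
  · have h1 : Function.HasTemperateGrowth (fun x : ℝ × ℝ => (x.1 : ℂ)) :=
      (Complex.ofRealCLM.comp (ContinuousLinearMap.fst ℝ ℝ ℝ)).hasTemperateGrowth
    have h2 : Function.HasTemperateGrowth (fun x : ℝ × ℝ => (x.2 : ℂ)) :=
      (Complex.ofRealCLM.comp (ContinuousLinearMap.snd ℝ ℝ ℝ)).hasTemperateGrowth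
    fun_prop
  · intro k
    refine ⟨k.factorial * Real.exp (1 + 1 / σ + σ * q ^ 2), fun x => ?_⟩
    have hre : (-σ * ((x.2 : ℂ) - q) ^ 2 - σ / 4 * (x.1 : ℂ) ^ 2 - Complex.I * p * x.1).re
        = -σ * (x.2 - q) ^ 2 - σ / 4 * x.1 ^ 2 := by
      have : (-σ * ((x.2 : ℂ) - q) ^ 2 - σ / 4 * (x.1 : ℂ) ^ 2 - Complex.I * p * x.1)
          = ((-σ * (x.2 - q) ^ 2 - σ / 4 * x.1 ^ 2 : ℝ) : ℂ)
            + ((-p * x.1 : ℝ) : ℂ) * Complex.I := by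
        push_cast
        ring
      rw [this, Complex.add_re, Complex.ofReal_re, Complex.re_ofReal_mul]
      simp
    rw [Complex.norm_exp, hre]
    have hs : ‖x‖ ^ 2 ≤ x.1 ^ 2 + x.2 ^ 2 := by
      rw [Prod.norm_def]
      rcases max_choice ‖x.1‖ ‖x.2‖ with h | h <;> rw [h, Real.norm_eq_abs, sq_abs] <;> nlinarith
    have hexp : -σ * (x.2 - q) ^ 2 - σ / 4 * x.1 ^ 2
        ≤ -(1 + ‖x‖) + (1 + 1 / σ + σ * q ^ 2) := by
      have h1 : ‖x‖ ≤ σ / 4 * ‖x‖ ^ 2 + 1 / σ := by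
        have : σ / 4 * ‖x‖ ^ 2 + 1 / σ - ‖x‖ = 1 / σ * (σ / 2 * ‖x‖ - 1) ^ 2 := by
          field_simp
          ring
        have h0 : 0 ≤ 1 / σ * (σ / 2 * ‖x‖ - 1) ^ 2 := by positivity
        linarith
      have h2 : σ / 4 * ‖x‖ ^ 2 ≤ σ / 4 * (x.1 ^ 2 + x.2 ^ 2) := by gcongr
      nlinarith [mul_nonneg hσ.le (sq_nonneg (x.2 - 2 * q)), mul_nonneg hσ.le (sq_nonneg x.2)]
    calc (1 + ‖x‖) ^ k * Real.exp (-σ * (x.2 - q) ^ 2 - σ / 4 * x.1 ^ 2)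
        ≤ (k.factorial * Real.exp (1 + ‖x‖)) *
            Real.exp (-(1 + ‖x‖) + (1 + 1 / σ + σ * q ^ 2)) := by
          have h := Real.pow_div_factorial_le_exp (1 + ‖x‖) (by positivity) k
          rw [div_le_iff₀ (by positivity)] at h
          gcongr
          linarith
      _ = _ := by
          rw [mul_assoc, ← Real.exp_add]
          congr 2
          ring

/-- The Gaussian pure states with mean `(q, p)`, position variance `1 / (2σ)` and no
position-momentum correlation. -/
theorem exists_gaussian_isState {σ : ℝ} (hσ : 0 < σ) (p q : ℝ) :
    ∃ ρ : 𝓢(ℝ × ℝ, ℂ), IsState ρ ∧ ∀ x r : ℝ, ρ (x, r) = (√(σ / Real.pi) : ℝ) *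
      Complex.exp (-σ * (r - q) ^ 2 - σ / 4 * x ^ 2 - Complex.I * p * x) := by
  obtain ⟨φ, hφ⟩ := exists_schwartzMap_gaussian hσ p q
  refine ⟨((√(σ / Real.pi) : ℝ) : ℂ) • φ, ⟨fun χ => ?_, ?_⟩, fun x r => ?_⟩
  -- the kernel is `ψ(q₁) conj ψ(q₂)` for the wave function `ψ`
  · let ψ : ℝ → ℂ := fun s => Complex.exp (-σ / 2 * (s - q) ^ 2 + Complex.I * p * s)
    have hconj : ∀ s, conj (ψ s) = Complex.exp (-σ / 2 * (s - q) ^ 2 - Complex.I * p * s) := by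
      intro s
      simp only [ψ, ← Complex.exp_conj]
      congr 1
      simp [Complex.conj_ofReal, sub_eq_add_neg, map_ofNat]
    have hk : ∀ q₁ q₂ : ℝ, conj (χ q₁) *
        (((√(σ / Real.pi) : ℝ) : ℂ) • φ) (q₂ - q₁, (q₁ + q₂) / 2) * χ q₂
        = ((√(σ / Real.pi) : ℝ) : ℂ) * (conj (χ q₁) * ψ q₁) * (conj (conj (χ q₂) * ψ q₂)) := by
      intro q₁ q₂
      have : φ (q₂ - q₁, (q₁ + q₂) / 2) = ψ q₁ * conj (ψ q₂) := by
        rw [hφ, hconj, ← Complex.exp_add]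
        congr 1
        push_cast
        ring
      simp only [smul_apply, smul_eq_mul, this, map_mul, Complex.conj_conj]
      ring
    simp only [hk]
    simp only [integral_const_mul, integral_mul_const, integral_conj]
    rw [mul_assoc, Complex.mul_conj]
    rw [← Complex.ofReal_mul]
    exact Complex.zero_le_real.2 (mul_nonneg (Real.sqrt_nonneg _) (Complex.normSq_nonneg _))
  · have : ∀ r : ℝ, (((√(σ / Real.pi) : ℝ) : ℂ) • φ) (0, r)
        = ((√(σ / Real.pi) * Real.exp (-σ * (r - q) ^ 2) : ℝ) : ℂ) := by
      intro r
      simp only [smul_apply, smul_eq_mul, hφ]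
      push_cast
      congr 2
      ring
    simp only [this]
    rw [integral_complex_ofReal, integral_const_mul,
      integral_sub_right_eq_self (fun r : ℝ => Real.exp (-σ * r ^ 2)) q, integral_gaussian,
      ← Real.sqrt_mul (by positivity), show σ / Real.pi * (Real.pi / σ) = 1 by
        field_simp, Real.sqrt_one, Complex.ofReal_one]
  · simp only [smul_apply, smul_eq_mul, hφ]

/-! ### Gaussian moments of Schwartz functions -/

theorem exists_schwartzMap_fderiv_bound (φ : 𝓢(ℝ × ℝ, ℂ)) (k : ℕ) :
    ∃ M : ℝ, 0 ≤ M ∧ ∀ x : ℝ × ℝ, (1 + ‖x‖) ^ k * (‖φ x‖ + ‖fderiv ℝ φ x‖) ≤ M := by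
  have h0 (x) := SchwartzMap.one_add_le_sup_seminorm_apply (𝕜 := ℝ) (m := (k, 1)) le_rfl
    zero_le_one φ x
  have h1 (x) := SchwartzMap.one_add_le_sup_seminorm_apply (𝕜 := ℝ) (m := (k, 1)) le_rfl
    le_rfl φ x
  simp only [norm_iteratedFDeriv_zero] at h0
  simp only [norm_iteratedFDeriv_one] at h1
  refine ⟨_, le_trans ?_ (add_le_add (h0 0) (h1 0)), fun x => ?_⟩
  · positivity
  · rw [mul_add]
    exact add_le_add (h0 x) (h1 x)

/-- The moment `∫ rⁿ exp (z r - m r²) ψ(r) dr`. -/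
def gaussMoment (n : ℕ) (ψ : ℝ → ℂ) (z : ℂ) (m : ℝ) : ℂ :=
  ∫ r : ℝ, (r : ℂ) ^ n * Complex.exp (z * r - m * r ^ 2) * ψ r

/-- The derivative of `(y, z, m) ↦ rⁿ exp (z r - m r²) φ(y, r)` at a fixed `r`. -/
def gaussMomentFDeriv (n : ℕ) (φ : 𝓢(ℝ × ℝ, ℂ)) (p : ℝ × ℂ × ℝ) (r : ℝ) : ℝ × ℂ × ℝ →L[ℝ] ℂ :=
  ((r : ℂ) ^ n * Complex.exp (p.2.1 * r - p.2.2 * r ^ 2)) •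
    ((fderiv ℝ φ (p.1, r)).comp
        ((ContinuousLinearMap.inl ℝ ℝ ℝ).comp (ContinuousLinearMap.fst ℝ ℝ (ℂ × ℝ))) +
      φ (p.1, r) • ((r : ℂ) • (ContinuousLinearMap.fst ℝ ℂ ℝ).comp
          (ContinuousLinearMap.snd ℝ ℝ (ℂ × ℝ)) -
        ((r : ℂ) ^ 2) • (Complex.ofRealCLM.comp (ContinuousLinearMap.snd ℝ ℂ ℝ)).comp
          (ContinuousLinearMap.snd ℝ ℝ (ℂ × ℝ))))

theorem gaussMomentFDeriv_apply (n : ℕ) (φ : 𝓢(ℝ × ℝ, ℂ)) (p v : ℝ × ℂ × ℝ) (r : ℝ) :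
    gaussMomentFDeriv n φ p r v =
      (r : ℂ) ^ n * Complex.exp (p.2.1 * r - p.2.2 * r ^ 2) *
        (fderiv ℝ φ (p.1, r) (v.1, 0) + φ (p.1, r) * (r * v.2.1 - r ^ 2 * v.2.2)) := by
  simp [gaussMomentFDeriv]
  ring

theorem hasFDerivAt_gaussMoment_integrand (n : ℕ) (φ : 𝓢(ℝ × ℝ, ℂ)) (p : ℝ × ℂ × ℝ) (r : ℝ) :
    HasFDerivAt (fun p : ℝ × ℂ × ℝ =>
        (r : ℂ) ^ n * Complex.exp (p.2.1 * r - p.2.2 * r ^ 2) * φ (p.1, r))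
      (gaussMomentFDeriv n φ p r) p := by
  have hφ : HasFDerivAt (fun p : ℝ × ℂ × ℝ => φ (p.1, r)) ((fderiv ℝ φ (p.1, r)).comp
      ((ContinuousLinearMap.inl ℝ ℝ ℝ).comp (ContinuousLinearMap.fst ℝ ℝ (ℂ × ℝ)))) p := by
    refine HasFDerivAt.comp (g := φ) p (φ.differentiableAt.hasFDerivAt) ?_
    refine (hasFDerivAt_fst.prodMk (hasFDerivAt_const r p)).congr_fderiv ?_
    ext <;> simp
  have hz : HasFDerivAt (fun p : ℝ × ℂ × ℝ => p.2.1)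
      ((ContinuousLinearMap.fst ℝ ℂ ℝ).comp (ContinuousLinearMap.snd ℝ ℝ (ℂ × ℝ))) p :=
    ((ContinuousLinearMap.fst ℝ ℂ ℝ).comp (ContinuousLinearMap.snd ℝ ℝ (ℂ × ℝ))).hasFDerivAt
  have hm : HasFDerivAt (fun p : ℝ × ℂ × ℝ => (p.2.2 : ℂ))
      ((Complex.ofRealCLM.comp (ContinuousLinearMap.snd ℝ ℂ ℝ)).comp
          (ContinuousLinearMap.snd ℝ ℝ (ℂ × ℝ))) p :=
    ((Complex.ofRealCLM.comp (ContinuousLinearMap.snd ℝ ℂ ℝ)).comp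
          (ContinuousLinearMap.snd ℝ ℝ (ℂ × ℝ))).hasFDerivAt
  have he := (((hz.mul_const (r : ℂ)).sub (hm.mul_const ((r : ℂ) ^ 2))).cexp.const_mul
    ((r : ℂ) ^ n)).mul hφ
  refine he.congr_fderiv ?_
  ext v <;> simp [gaussMomentFDeriv] <;> ring

theorem norm_gaussMoment_exp_le {z : ℂ} {m C m₀ : ℝ} (hm₀ : 0 < m₀) (hz : ‖z‖ ≤ C) (hm : m₀ ≤ m)
    (r : ℝ) : ‖Complex.exp (z * r - m * r ^ 2)‖ ≤ Real.exp (C ^ 2 / (4 * m₀)) := by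
  rw [Complex.norm_exp]
  refine Real.exp_le_exp.2 ?_
  have h1 : (z * r - m * r ^ 2 : ℂ).re = z.re * r - m * r ^ 2 := by
    have : (m * r ^ 2 : ℂ) = ((m * r ^ 2 : ℝ) : ℂ) := by push_cast; rfl
    rw [this, Complex.sub_re, Complex.re_mul_ofReal, Complex.ofReal_re]
  have h2 : z.re * r ≤ C * |r| := by
    calc z.re * r ≤ |z.re * r| := le_abs_self _
      _ = |z.re| * |r| := abs_mul _ _
      _ ≤ C * |r| := by
        gcongr
        exact (Complex.abs_re_le_norm z).trans hz
  have h3 : m₀ * |r| ^ 2 ≤ m * r ^ 2 := by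
    rw [sq_abs]
    gcongr
  have h4 : C * |r| - m₀ * |r| ^ 2 ≤ C ^ 2 / (4 * m₀) := by
    rw [le_div_iff₀ (by positivity)]
    nlinarith [sq_nonneg (2 * m₀ * |r| - C)]
  rw [h1]
  linarith

theorem exists_gaussMoment_bound (n : ℕ) (φ : 𝓢(ℝ × ℝ, ℂ)) {C m₀ : ℝ} (hm₀ : 0 < m₀) :
    ∃ bound : ℝ → ℝ, Integrable bound ∧ ∀ p : ℝ × ℂ × ℝ, ‖p.2.1‖ ≤ C → m₀ ≤ p.2.2 → ∀ r : ℝ,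
      ‖(r : ℂ) ^ n * Complex.exp (p.2.1 * r - p.2.2 * r ^ 2) * φ (p.1, r)‖ ≤ bound r ∧
      ‖gaussMomentFDeriv n φ p r‖ ≤ bound r := by
  obtain ⟨M, hM0, hM⟩ := exists_schwartzMap_fderiv_bound φ (n + 4)
  refine ⟨fun r => Real.exp (C ^ 2 / (4 * m₀)) * (M * (1 + r ^ 2)⁻¹),
    (integrable_inv_one_add_sq.const_mul _).const_mul _, fun p hz hm r => ?_⟩
  have hexp := norm_gaussMoment_exp_le hm₀ hz hm r
  set N := ‖φ (p.1, r)‖ + ‖fderiv ℝ φ (p.1, r)‖ with hN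
  have hN0 : 0 ≤ N := by positivity
  have hr : |r| ≤ ‖(p.1, r)‖ := by
    rw [Prod.norm_def]
    exact le_max_right _ _
  have hpow : |r| ^ n * ((1 + |r|) ^ 2 * N) ≤ M * (1 + r ^ 2)⁻¹ := by
    rw [← div_eq_mul_inv, le_div_iff₀ (by positivity)]
    have h1 : |r| ^ n ≤ (1 + |r|) ^ n := by
      gcongr
      linarith
    have h2 : 1 + r ^ 2 ≤ (1 + |r|) ^ 2 := by
      rw [← sq_abs r]
      nlinarith [abs_nonneg r]
    calc |r| ^ n * ((1 + |r|) ^ 2 * N) * (1 + r ^ 2)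
        ≤ (1 + |r|) ^ n * ((1 + |r|) ^ 2 * N) * (1 + |r|) ^ 2 := by gcongr
      _ = (1 + |r|) ^ (n + 4) * N := by ring
      _ ≤ (1 + ‖(p.1, r)‖) ^ (n + 4) * N := by gcongr
      _ ≤ M := hM (p.1, r)
  have hone : 1 ≤ (1 + |r|) ^ 2 := one_le_pow₀ (by simp)
  constructor
  · rw [norm_mul, norm_mul, norm_pow, Complex.norm_real, Real.norm_eq_abs]
    calc |r| ^ n * ‖Complex.exp (p.2.1 * r - p.2.2 * r ^ 2)‖ * ‖φ (p.1, r)‖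
        ≤ |r| ^ n * Real.exp (C ^ 2 / (4 * m₀)) * ((1 + |r|) ^ 2 * N) := by
          gcongr
          calc ‖φ (p.1, r)‖ ≤ 1 * N := by rw [one_mul]; simp [hN]
            _ ≤ _ := by gcongr
      _ = Real.exp (C ^ 2 / (4 * m₀)) * (|r| ^ n * ((1 + |r|) ^ 2 * N)) := by ring
      _ ≤ _ := mul_le_mul_of_nonneg_left hpow (Real.exp_nonneg _)
  · refine ContinuousLinearMap.opNorm_le_bound _ (by positivity) fun v => ?_
    rw [gaussMomentFDeriv_apply, norm_mul, norm_mul, norm_pow, Complex.norm_real,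
      Real.norm_eq_abs]
    have hv1 : ‖v.1‖ ≤ ‖v‖ := norm_fst_le v
    have hv2 : ‖v.2.1‖ ≤ ‖v‖ := (norm_fst_le v.2).trans (norm_snd_le v)
    have hv3 : ‖v.2.2‖ ≤ ‖v‖ := (norm_snd_le v.2).trans (norm_snd_le v)
    have hin : ‖fderiv ℝ φ (p.1, r) (v.1, 0) + φ (p.1, r) * (r * v.2.1 - r ^ 2 * v.2.2)‖
        ≤ (1 + |r|) ^ 2 * N * ‖v‖ := by
      have h1 : ‖fderiv ℝ φ (p.1, r) (v.1, 0)‖ ≤ ‖fderiv ℝ φ (p.1, r)‖ * ‖v‖ := by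
        refine (ContinuousLinearMap.le_opNorm _ _).trans ?_
        gcongr
        simp [Prod.norm_def]
      have h2 : ‖(r * v.2.1 - r ^ 2 * v.2.2 : ℂ)‖ ≤ (|r| + |r| ^ 2) * ‖v‖ := by
        refine (norm_sub_le _ _).trans ?_
        rw [norm_mul, norm_mul, norm_pow, Complex.norm_real, Complex.norm_real, Real.norm_eq_abs r,
          add_mul]
        gcongr
      calc _ ≤ ‖fderiv ℝ φ (p.1, r)‖ * ‖v‖ + ‖φ (p.1, r)‖ * ((|r| + |r| ^ 2) * ‖v‖) := by
            refine (norm_add_le _ _).trans ?_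
            rw [norm_mul]
            gcongr
        _ ≤ ((1 + |r|) ^ 2 * ‖fderiv ℝ φ (p.1, r)‖) * ‖v‖
            + ‖φ (p.1, r)‖ * ((1 + |r|) ^ 2 * ‖v‖) := by
            gcongr
            · exact le_mul_of_one_le_left (norm_nonneg _) hone
            · nlinarith [abs_nonneg r]
        _ = _ := by rw [hN]; ring
    calc |r| ^ n * ‖Complex.exp (p.2.1 * r - p.2.2 * r ^ 2)‖ *
          ‖fderiv ℝ φ (p.1, r) (v.1, 0) + φ (p.1, r) * (r * v.2.1 - r ^ 2 * v.2.2)‖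
        ≤ |r| ^ n * Real.exp (C ^ 2 / (4 * m₀)) * ((1 + |r|) ^ 2 * N * ‖v‖) := by gcongr
      _ = Real.exp (C ^ 2 / (4 * m₀)) * (|r| ^ n * ((1 + |r|) ^ 2 * N)) * ‖v‖ := by ring
      _ ≤ _ := mul_le_mul_of_nonneg_right
        (mul_le_mul_of_nonneg_left hpow (Real.exp_nonneg _)) (norm_nonneg _)

theorem continuous_schwartzMap_slice (φ : 𝓢(ℝ × ℝ, ℂ)) (y : ℝ) :
    Continuous fun r : ℝ => φ (y, r) :=
  φ.continuous.comp (by fun_prop)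

/-- Differentiation under the integral sign, jointly in the slice of the Schwartz function and in
the coefficients of the Gaussian, along a curve that is differentiable at one point. -/
theorem hasDerivWithinAt_gaussMoment (n : ℕ) (φ : 𝓢(ℝ × ℝ, ℂ)) {y m : ℝ → ℝ} {z : ℝ → ℂ}
    {y' m' : ℝ} {z' : ℂ} {S : Set ℝ} {t : ℝ} (hy : HasDerivWithinAt y y' S t)
    (hz : HasDerivWithinAt z z' S t) (hm : HasDerivWithinAt m m' S t) (hpos : 0 < m t) :
    HasDerivWithinAt (fun s => gaussMoment n (fun r => φ (y s, r)) (z s) (m s))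
      (y' * gaussMoment n (fun r => fderiv ℝ φ (y t, r) (1, 0)) (z t) (m t)
        + z' * gaussMoment (n + 1) (fun r => φ (y t, r)) (z t) (m t)
        - m' * gaussMoment (n + 2) (fun r => φ (y t, r)) (z t) (m t)) S t := by
  obtain ⟨bound, hint, hbound⟩ := exists_gaussMoment_bound n φ (C := ‖z t‖ + 1)
    (half_pos hpos)
  let p₀ : ℝ × ℂ × ℝ := (y t, z t, m t)
  let U : Set (ℝ × ℂ × ℝ) := {p | ‖p.2.1‖ < ‖z t‖ + 1 ∧ m t / 2 < p.2.2}
  have hU : U ∈ 𝓝 p₀ := by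
    refine IsOpen.mem_nhds ?_ ⟨by simp [p₀], by simp [p₀, hpos]⟩
    have h1 : Continuous fun p : ℝ × ℂ × ℝ => ‖p.2.1‖ := by fun_prop
    have h2 : Continuous fun p : ℝ × ℂ × ℝ => p.2.2 := by fun_prop
    exact (isOpen_lt h1 continuous_const).inter (isOpen_lt continuous_const h2)
  have hp₀ : p₀ ∈ U := mem_of_mem_nhds hU
  have hb (p : ℝ × ℂ × ℝ) (hp : p ∈ U) := hbound p hp.1.le hp.2.le
  have hmeas (p : ℝ × ℂ × ℝ) : AEStronglyMeasurable (fun r : ℝ =>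
      (r : ℂ) ^ n * Complex.exp (p.2.1 * r - p.2.2 * r ^ 2) * φ (p.1, r)) volume := by
    have := continuous_schwartzMap_slice φ p.1
    exact Continuous.aestronglyMeasurable (by fun_prop)
  have hmeas' : AEStronglyMeasurable (gaussMomentFDeriv n φ p₀) volume := by
    refine Continuous.aestronglyMeasurable ?_
    unfold gaussMomentFDeriv
    have h1 := continuous_schwartzMap_slice φ p₀.1
    have h2 : Continuous fun r : ℝ => fderiv ℝ φ (p₀.1, r) :=
      ((φ.smooth 1).continuous_fderiv (by norm_num)).comp (by fun_prop)
    have h3 := h2.clm_comp (continuous_const (y := (ContinuousLinearMap.inl ℝ ℝ ℝ).comp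
      (ContinuousLinearMap.fst ℝ ℝ (ℂ × ℝ))))
    fun_prop
  have hint' : Integrable (gaussMomentFDeriv n φ p₀) :=
    hint.mono' hmeas' (.of_forall fun r => (hb p₀ hp₀ r).2)
  have hF := hasFDerivAt_integral_of_dominated_of_fderiv_le (𝕜 := ℝ) (μ := volume)
    (F := fun (p : ℝ × ℂ × ℝ) (r : ℝ) =>
      (r : ℂ) ^ n * Complex.exp (p.2.1 * r - p.2.2 * r ^ 2) * φ (p.1, r))
    (F' := gaussMomentFDeriv n φ) (bound := bound) hU (.of_forall hmeas)
    (hint.mono' (hmeas p₀) (.of_forall fun r => (hb p₀ hp₀ r).1)) hmeas'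
    (.of_forall fun r p hp => (hb p hp r).2) hint
    (.of_forall fun r p _ => hasFDerivAt_gaussMoment_integrand n φ p r)
  have hcurve : HasDerivWithinAt (fun s => ((y s, z s, m s) : ℝ × ℂ × ℝ)) (y', z', m') S t :=
    hy.prodMk (hz.prodMk hm)
  refine (hF.comp_hasDerivWithinAt (f := fun s => ((y s, z s, m s) : ℝ × ℂ × ℝ)) t hcurve
    ).congr_deriv ?_
  have hsplit : ((y', z', m') : ℝ × ℂ × ℝ) = (y', 0, 0) + (0, z', 0) - (0, 0, -m') := by
    ext <;> simp
  rw [hsplit, map_sub, map_add]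
  simp only [ContinuousLinearMap.integral_apply hint', gaussMomentFDeriv_apply, p₀]
  unfold gaussMoment
  simp only [← integral_const_mul]
  have hzero : ((0 : ℝ), (0 : ℝ)) = 0 := rfl
  refine congrArg₂ _ (congrArg₂ _ (integral_congr_ae (.of_forall fun r => ?_))
    (integral_congr_ae (.of_forall fun r => ?_))) (integral_congr_ae (.of_forall fun r => ?_))
  · have : ((y', 0) : ℝ × ℝ) = y' • (1, 0) := by simp
    simp only [this, map_smul, Complex.real_smul]
    push_cast
    ring
  · simp only [hzero, map_zero]
    push_cast
    ring
  · simp only [hzero, map_zero]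
    push_cast
    ring

/-! ### Quadratic generators on Gaussian kernels -/

/-- The kernel `C exp (u x² + v x r + w r² + k x + l r)`. -/
def gaussKernel (C u v w k l : ℂ) : Kernel := fun x r =>
  C * Complex.exp (u * x ^ 2 + v * x * r + w * r ^ 2 + k * x + l * r)

/-- The factor by which a quadratic generator multiplies the Gaussian kernel
`exp h`, `h = u x² + v x r + w r² + k x + l r`; it depends on `∂_x h = 2 u x + v r + k` and
`∂_r h = v x + 2 w r + l`. -/
def QuadGenerator.symbol (g : QuadGenerator) (u v w k l : ℂ) (x r : ℝ) : ℂ :=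
  g.Lc + g.X 0 0 * ((2 * u * x + v * r + k) ^ 2 + 2 * u)
    + (g.X 0 1 + g.X 1 0) * ((2 * u * x + v * r + k) * (v * x + 2 * w * r + l) + v)
    + g.X 1 1 * ((v * x + 2 * w * r + l) ^ 2 + 2 * w)
    + (x * g.Y 0 0 + r * g.Y 1 0) * (2 * u * x + v * r + k)
    + (x * g.Y 0 1 + r * g.Y 1 1) * (v * x + 2 * w * r + l)
    + g.Z 0 0 * x ^ 2 + (g.Z 0 1 + g.Z 1 0) * x * r + g.Z 1 1 * r ^ 2

theorem hasDerivAt_gaussKernel_fst (C u v w k l : ℂ) (x r : ℝ) :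
    HasDerivAt (fun y : ℝ => gaussKernel C u v w k l y r)
      ((2 * u * x + v * r + k) * gaussKernel C u v w k l x r) x := by
  have hx : HasDerivAt (fun y : ℝ => (y : ℂ)) 1 x := Complex.ofRealCLM.hasDerivAt
  have h := ((((((hx.pow 2).const_mul u).add ((hx.const_mul v).mul_const (r : ℂ))).add_const
    (w * (r : ℂ) ^ 2)).add (hx.const_mul k)).add_const (l * (r : ℂ))).cexp.const_mul C
  refine h.congr_deriv ?_
  simp only [gaussKernel, Pi.add_apply, Pi.pow_apply]
  push_cast
  ring

theorem hasDerivAt_gaussKernel_snd (C u v w k l : ℂ) (x r : ℝ) :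
    HasDerivAt (fun s : ℝ => gaussKernel C u v w k l x s)
      ((v * x + 2 * w * r + l) * gaussKernel C u v w k l x r) r := by
  have hr : HasDerivAt (fun y : ℝ => (y : ℂ)) 1 r := Complex.ofRealCLM.hasDerivAt
  have h := (((((hr.const_mul (v * (x : ℂ))).const_add (u * (x : ℂ) ^ 2)).add
    ((hr.pow 2).const_mul w)).add_const (k * (x : ℂ))).add (hr.const_mul l)).cexp.const_mul C
  refine h.congr_deriv ?_
  simp only [gaussKernel, Pi.add_apply, Pi.pow_apply]
  push_cast
  ring

theorem pd_zero_apply (f : Kernel) (x r : ℝ) : pd 0 f x r = deriv (fun y => f y r) x := rfl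

theorem pd_one_apply (f : Kernel) (x r : ℝ) : pd 1 f x r = deriv (fun s => f x s) r := rfl

theorem pd_zero_gaussKernel (C u v w k l : ℂ) : pd 0 (gaussKernel C u v w k l) =
    fun x r => (2 * u * x + v * r + k) * gaussKernel C u v w k l x r := by
  ext x r
  exact (hasDerivAt_gaussKernel_fst C u v w k l x r).deriv

theorem pd_one_gaussKernel (C u v w k l : ℂ) : pd 1 (gaussKernel C u v w k l) =
    fun x r => (v * x + 2 * w * r + l) * gaussKernel C u v w k l x r := by
  ext x r
  exact (hasDerivAt_gaussKernel_snd C u v w k l x r).deriv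

theorem hasDerivAt_ofReal_affine (a b : ℂ) (x : ℝ) :
    HasDerivAt (fun y : ℝ => a * (y : ℂ) + b) a x := by
  simpa using ((Complex.ofRealCLM.hasDerivAt (x := x)).const_mul a).add_const b

theorem QuadGenerator.act_gaussKernel (g : QuadGenerator) (C u v w k l : ℂ) (x r : ℝ) :
    g.act (gaussKernel C u v w k l) x r =
      g.symbol u v w k l x r * gaussKernel C u v w k l x r := by
  have h00 : pd 0 (pd 0 (gaussKernel C u v w k l)) x r
      = ((2 * u * x + v * r + k) ^ 2 + 2 * u) * gaussKernel C u v w k l x r := by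
    rw [pd_zero_gaussKernel, pd_zero_apply]
    have h := (hasDerivAt_ofReal_affine (2 * u) (v * r + k) x).mul
      (hasDerivAt_gaussKernel_fst C u v w k l x r)
    simp only [← add_assoc] at h
    refine h.deriv.trans ?_
    ring
  have h01 : pd 0 (pd 1 (gaussKernel C u v w k l)) x r
      = ((2 * u * x + v * r + k) * (v * x + 2 * w * r + l) + v) *
        gaussKernel C u v w k l x r := by
    rw [pd_one_gaussKernel, pd_zero_apply]
    have h := (hasDerivAt_ofReal_affine v (2 * w * r + l) x).mul
      (hasDerivAt_gaussKernel_fst C u v w k l x r)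
    simp only [← add_assoc] at h
    refine h.deriv.trans ?_
    ring
  have h10 : pd 1 (pd 0 (gaussKernel C u v w k l)) x r
      = ((2 * u * x + v * r + k) * (v * x + 2 * w * r + l) + v) *
        gaussKernel C u v w k l x r := by
    rw [pd_zero_gaussKernel, pd_one_apply]
    have h := (hasDerivAt_ofReal_affine v (2 * u * x + k) r).mul
      (hasDerivAt_gaussKernel_snd C u v w k l x r)
    have e : (fun s : ℝ => (2 * u * x + v * s + k) * gaussKernel C u v w k l x s)
        = (fun s : ℝ => v * (s : ℂ) + (2 * u * x + k)) * fun s => gaussKernel C u v w k l x s := by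
      ext s
      simp only [Pi.mul_apply]
      ring
    rw [e]
    refine h.deriv.trans ?_
    ring
  have h11 : pd 1 (pd 1 (gaussKernel C u v w k l)) x r
      = ((v * x + 2 * w * r + l) ^ 2 + 2 * w) * gaussKernel C u v w k l x r := by
    rw [pd_one_gaussKernel, pd_one_apply]
    have h := (hasDerivAt_ofReal_affine (2 * w) (v * x + l) r).mul
      (hasDerivAt_gaussKernel_snd C u v w k l x r)
    have e : (fun s : ℝ => (v * x + 2 * w * s + l) * gaussKernel C u v w k l x s)
        = (fun s : ℝ => 2 * w * (s : ℂ) + (v * x + l)) *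
          fun s => gaussKernel C u v w k l x s := by
      ext s
      simp only [Pi.mul_apply]
      ring
    rw [e]
    refine h.deriv.trans ?_
    ring
  simp only [QuadGenerator.act, Fin.sum_univ_two, h00, h01, h10, h11]
  simp only [pd_zero_gaussKernel, pd_one_gaussKernel, QuadGenerator.symbol,
    Matrix.cons_val_zero, Matrix.cons_val_one]
  ring

/-- Two symbols that differ only by `κ x`, for a family of Gaussian kernels whose linear
coefficients fill a real plane that spans `ℂ²`, agree: then `κ = 0` and the two generators have the
same coefficients, up to the antisymmetric parts of `X` and `Z`. -/
theorem QuadGenerator.eq_of_symbol_eq {g g' : QuadGenerator} {κ u v w k₀ a μ ν : ℂ}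
    (ha : a ≠ 0) (hν : ν ≠ 0)
    (h : ∀ p q x r : ℝ, g.symbol u v w (k₀ + a * p + μ * q) (ν * q) x r =
      g'.symbol u v w (k₀ + a * p + μ * q) (ν * q) x r + κ * x) :
    κ = 0 ∧ ((g.X.IsSymm ∧ g.Z.IsSymm) → (g'.X.IsSymm ∧ g'.Z.IsSymm) → g = g') := by
  simp only [QuadGenerator.symbol] at h
  have hX00 : g.X 0 0 = g'.X 0 0 := by
    have h0 := h 0 0 0 0
    have h1 := h 1 0 0 0
    have h2 := h (-1) 0 0 0
    push_cast at h0 h1 h2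
    have : (g.X 0 0 - g'.X 0 0) * a ^ 2 = 0 := by
      linear_combination (1 / 2 : ℂ) * h1 + (1 / 2 : ℂ) * h2 - h0
    simpa [ha, sub_eq_zero] using this
  have hX01 : g.X 0 1 + g.X 1 0 = g'.X 0 1 + g'.X 1 0 := by
    have h0 := h 0 0 0 0
    have h1 := h 1 0 0 0
    have h2 := h 0 1 0 0
    have h3 := h 1 1 0 0
    push_cast at h0 h1 h2 h3
    have : ((g.X 0 1 + g.X 1 0) - (g'.X 0 1 + g'.X 1 0)) * (a * ν) = 0 := by
      rw [hX00] at h0 h1 h2 h3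
      linear_combination h3 - h1 - h2 + h0
    simpa [ha, hν, sub_eq_zero] using this
  have hX11 : g.X 1 1 = g'.X 1 1 := by
    have h0 := h 0 0 0 0
    have h1 := h 0 1 0 0
    have h2 := h 0 (-1) 0 0
    push_cast at h0 h1 h2
    rw [hX00, hX01] at h0 h1 h2
    have : (g.X 1 1 - g'.X 1 1) * ν ^ 2 = 0 := by
      linear_combination (1 / 2 : ℂ) * h1 + (1 / 2 : ℂ) * h2 - h0
    simpa [hν, sub_eq_zero] using this
  simp only [hX00, hX01, hX11] at h
  have hLc : g.Lc = g'.Lc := by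
    have h0 := h 0 0 0 0
    push_cast at h0
    linear_combination h0
  have hY00 : g.Y 0 0 = g'.Y 0 0 := by
    have h0 := h 0 0 1 0
    have h1 := h 1 0 1 0
    push_cast at h0 h1
    have : (g.Y 0 0 - g'.Y 0 0) * a = 0 := by linear_combination h1 - h0
    simpa [ha, sub_eq_zero] using this
  have hY10 : g.Y 1 0 = g'.Y 1 0 := by
    have h0 := h 0 0 0 1
    have h1 := h 1 0 0 1
    push_cast at h0 h1
    have : (g.Y 1 0 - g'.Y 1 0) * a = 0 := by linear_combination h1 - h0
    simpa [ha, sub_eq_zero] using this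
  simp only [hLc, hY00, hY10] at h
  have hY01 : g.Y 0 1 = g'.Y 0 1 := by
    have h0 := h 0 0 1 0
    have h1 := h 0 1 1 0
    push_cast at h0 h1
    have : (g.Y 0 1 - g'.Y 0 1) * ν = 0 := by linear_combination h1 - h0
    simpa [hν, sub_eq_zero] using this
  have hY11 : g.Y 1 1 = g'.Y 1 1 := by
    have h0 := h 0 0 0 1
    have h1 := h 0 1 0 1
    push_cast at h0 h1
    have : (g.Y 1 1 - g'.Y 1 1) * ν = 0 := by linear_combination h1 - h0
    simpa [hν, sub_eq_zero] using this
  simp only [hY01, hY11] at h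
  have h1 := h 0 0 1 0
  have h2 := h 0 0 (-1) 0
  have h3 := h 0 0 0 1
  have h4 := h 0 0 1 1
  push_cast at h1 h2 h3 h4
  have hκ : κ = 0 := by linear_combination (1 / 2 : ℂ) * h2 - (1 / 2 : ℂ) * h1
  have hZ00 : g.Z 0 0 = g'.Z 0 0 := by linear_combination h1 + hκ
  have hZ11 : g.Z 1 1 = g'.Z 1 1 := by linear_combination h3
  have hZ01 : g.Z 0 1 + g.Z 1 0 = g'.Z 0 1 + g'.Z 1 0 := by linear_combination h4 - h1 - h3
  refine ⟨hκ, fun hs hs' => ?_⟩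
  have s1 := hs.1.apply 0 1
  have s2 := hs.2.apply 0 1
  have s3 := hs'.1.apply 0 1
  have s4 := hs'.2.apply 0 1
  have hX01' : g.X 0 1 = g'.X 0 1 := by
    linear_combination (1 / 2 : ℂ) * (hX01 - s1 + s3)
  have hZ01' : g.Z 0 1 = g'.Z 0 1 := by
    linear_combination (1 / 2 : ℂ) * (hZ01 - s2 + s4)
  refine QuadGenerator.ext hLc ?_ ?_ ?_
  · ext i j
    fin_cases i <;> fin_cases j <;> simp [hX00, hX11, hX01', s1, s3]
  · ext i j
    fin_cases i <;> fin_cases j <;> simp [hY00, hY11, hY01, hY10]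
  · ext i j
    fin_cases i <;> fin_cases j <;> simp [hZ00, hZ11, hZ01', s2, s4]

/-! ### The obstruction to a master equation -/

/-- If an evolution obeys `∂_t ρ = L_t ρ + κ x ρ` and maps the coherent states to Gaussian kernels
with a nondegenerate family of linear coefficients, a master equation forces `κ = 0`, and then `L`
is the only symmetric generator. -/
theorem MasterEquation.eq_generator {S : Set ℝ} (hS : UniqueDiffOn ℝ S)
    {Φ : ℝ → 𝓢(ℝ × ℝ, ℂ) → Kernel} {L g : ℝ → QuadGenerator} {κ : ℝ → ℂ}
    (hΦ : ∀ ρ : 𝓢(ℝ × ℝ, ℂ), ∀ t ∈ S, ∀ x r : ℝ, HasDerivWithinAt (fun s => Φ s ρ x r)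
      ((L t).act (Φ t ρ) x r + κ t * x * Φ t ρ x r) S t)
    (hgauss : ∀ t ∈ S, ∃ u v w k₀ a μ ν : ℂ, a ≠ 0 ∧ ν ≠ 0 ∧ ∀ p q : ℝ,
      ∃ ρ : 𝓢(ℝ × ℝ, ℂ), IsState ρ ∧ ∃ C : ℂ, C ≠ 0 ∧
        Φ t ρ = gaussKernel C u v w (k₀ + a * p + μ * q) (ν * q))
    (hg : MasterEquation S Φ fun t => (g t).act) {t : ℝ} (ht : t ∈ S) :
    κ t = 0 ∧ (((g t).X.IsSymm ∧ (g t).Z.IsSymm) → ((L t).X.IsSymm ∧ (L t).Z.IsSymm) →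
      g t = L t) := by
  obtain ⟨u, v, w, k₀, a, μ, ν, ha, hν, hρ⟩ := hgauss t ht
  refine QuadGenerator.eq_of_symbol_eq ha hν (u := u) (v := v) (w := w) (k₀ := k₀) (μ := μ)
    fun p q x r => ?_
  obtain ⟨ρ, hst, C, hC, hK⟩ := hρ p q
  have h := (hS t ht).eq_deriv _ (hg ρ hst t ht x r) (hΦ ρ t ht x r)
  simp only [hK, QuadGenerator.act_gaussKernel] at h
  refine mul_right_cancel₀ (b := gaussKernel C u v w (k₀ + a * p + μ * q) (ν * q) x r)
    (mul_ne_zero hC (Complex.exp_ne_zero _)) ?_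
  rw [h]
  ring

/-- `c' = c A' / A` on an interval means that `c` is a constant multiple of `A`. -/
theorem exists_eq_mul_iff {S : Set ℝ} (hS : Convex ℝ S) (hU : UniqueDiffOn ℝ S)
    (hne : S.Nonempty) {c A : ℝ → ℝ}
    (hc : DifferentiableOn ℝ c S) (hA : DifferentiableOn ℝ A S) (hA0 : ∀ t ∈ S, A t ≠ 0) :
    (∃ k : ℝ, ∀ t ∈ S, c t = k * A t) ↔
      ∀ t ∈ S, derivWithin c S t - c t * derivWithin A S t / A t = 0 := by
  constructor
  · rintro ⟨k, hk⟩ t ht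
    have h1 : derivWithin c S t = k * derivWithin A S t := by
      rw [derivWithin_congr hk (hk t ht), derivWithin_const_mul _ (hA t ht)]
    rw [h1, hk t ht]
    field_simp [hA0 t ht]
    ring
  · intro h
    obtain ⟨t₀, ht₀⟩ := hne
    refine ⟨c t₀ / A t₀, fun t ht => ?_⟩
    have hd : DifferentiableOn ℝ (fun s => c s / A s) S := hc.fun_div hA hA0
    have hz : ∀ s ∈ S, fderivWithin ℝ (fun s => c s / A s) S s = 0 := by
      intro s hs
      have h1 := ((hc s hs).hasDerivWithinAt.fun_div (hA s hs).hasDerivWithinAt (hA0 s hs))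
      have h2 : (derivWithin c S s * A s - c s * derivWithin A S s) / A s ^ 2 = 0 := by
        have h3 := h s hs
        have := hA0 s hs
        field_simp at h3 ⊢
        linarith
      rw [h2] at h1
      have h4 := h1.hasFDerivWithinAt.fderivWithin (hU s hs)
      rw [h4]
      ext
      simp
    have := hS.is_const_of_fderivWithin_eq_zero hd hz ht ht₀
    have h1 := hA0 t ht
    rw [← this, div_mul_cancel₀ _ h1]

/-! ### Operations with one delta factor -/

theorem Exponent.DifferentiableFamily.differentiableOn {p : ℝ → Exponent} {S : Set ℝ}
    (h : Exponent.DifferentiableFamily p S) :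
    (DifferentiableOn ℝ (fun t => (p t).a₁) S ∧ DifferentiableOn ℝ (fun t => (p t).a₂) S ∧
      DifferentiableOn ℝ (fun t => (p t).a₃) S) ∧
    (DifferentiableOn ℝ (fun t => (p t).b₁) S ∧ DifferentiableOn ℝ (fun t => (p t).b₂) S ∧
      DifferentiableOn ℝ (fun t => (p t).b₃) S ∧ DifferentiableOn ℝ (fun t => (p t).b₄) S) ∧
    (DifferentiableOn ℝ (fun t => (p t).c₁) S ∧ DifferentiableOn ℝ (fun t => (p t).c₂) S) ∧
    (DifferentiableOn ℝ (fun t => (p t).e₁) S ∧ DifferentiableOn ℝ (fun t => (p t).e₂) S) := by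
  simp only [Exponent.DifferentiableFamily, List.forall_mem_cons] at h
  tauto

theorem FormI.act_apply {J : FormI} (hJ : J.TracePreserving) (ρ : 𝓢(ℝ × ℝ, ℂ)) (x r : ℝ) :
    J.act ρ x r = (√(J.e₁ / Real.pi) : ℝ) *
      Complex.exp (Complex.I * (J.l₁ * x * r + J.c * x) - J.l₃ * x ^ 2 - J.e₁ * r ^ 2) *
      gaussMoment 0 (fun r' => ρ (J.A * x, r')) (Complex.I * J.l₂ * x - J.e₂ * r)
        (J.e₂ ^ 2 / (4 * J.e₁)) := by
  obtain ⟨hβ, he, h3, hd1, hd2⟩ := hJ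
  have hx : J.α * x / J.β = J.A * x := by
    unfold FormI.A
    ring
  have hnorm : (J.norm : ℂ) * ((1 / |J.β| : ℝ) : ℂ) = (√(J.e₁ / Real.pi) : ℝ) := by
    rw [← Complex.ofReal_mul]
    congr 1
    have : |J.β| ≠ 0 := abs_ne_zero.2 hβ
    unfold FormI.norm
    field_simp
  rw [FormI.act, hnorm, mul_assoc]
  congr 1
  rw [gaussMoment, ← integral_const_mul]
  refine integral_congr_ae (.of_forall fun r' => ?_)
  have h3' : J.e₃ = J.e₂ ^ 2 / (4 * J.e₁) := by linarith
  simp only [hx]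
  rw [pow_zero, one_mul, ← mul_assoc, ← Complex.exp_add]
  congr 2
  simp only [Exponent.eval, h3', hd1, hd2, FormI.l₁, FormI.l₂, FormI.l₃, FormI.c]
  push_cast
  ring

theorem hasDerivAt_gaussMoment_fst (n : ℕ) (φ : 𝓢(ℝ × ℝ, ℂ)) (A m : ℝ) (hm : 0 < m) (a b : ℂ)
    (x : ℝ) :
    HasDerivAt (fun x : ℝ => gaussMoment n (fun r => φ (A * x, r)) (a * x + b) m)
      (A * gaussMoment n (fun r => fderiv ℝ φ (A * x, r) (1, 0)) (a * x + b) m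
        + a * gaussMoment (n + 1) (fun r => φ (A * x, r)) (a * x + b) m) x := by
  have hy : HasDerivAt (fun x : ℝ => A * x) A x := by
    simpa using (hasDerivAt_id x).const_mul A
  have h := hasDerivWithinAt_gaussMoment n φ hy.hasDerivWithinAt
    (hasDerivAt_ofReal_affine a b x).hasDerivWithinAt
    (hasDerivAt_const x m).hasDerivWithinAt hm (S := univ)
  rw [hasDerivWithinAt_univ] at h
  exact h.congr_deriv (by simp)

theorem hasDerivAt_gaussMoment_snd (n : ℕ) (φ : 𝓢(ℝ × ℝ, ℂ)) (y m : ℝ) (hm : 0 < m) (a b : ℂ)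
    (r : ℝ) :
    HasDerivAt (fun r : ℝ => gaussMoment n (fun r => φ (y, r)) (a * r + b) m)
      (a * gaussMoment (n + 1) (fun r => φ (y, r)) (a * r + b) m) r := by
  have h := hasDerivWithinAt_gaussMoment n φ (hasDerivAt_const r y).hasDerivWithinAt
    (hasDerivAt_ofReal_affine a b r).hasDerivWithinAt
    (hasDerivAt_const r m).hasDerivWithinAt hm (S := univ)
  rw [hasDerivWithinAt_univ] at h
  exact h.congr_deriv (by simp)

/-- A generator whose only second derivative is `∂_r²`, applied to an output kernel
`N exp (i (l₁ x r + c x) - l₃ x² - e₁ r²) K₀` of `J_I`, in terms of Gaussian moments. -/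
theorem FormI.generator_act {J : ℝ → FormI} {t : ℝ} (hJ : (J t).TracePreserving)
    (he₂ : (J t).e₂ ≠ 0) (ρ : 𝓢(ℝ × ℝ, ℂ)) (x r : ℝ) (g : QuadGenerator)
    (hX : g.X 0 0 = 0 ∧ g.X 0 1 = 0 ∧ g.X 1 0 = 0) :
    let m := (J t).e₂ ^ 2 / (4 * (J t).e₁)
    let z : ℂ := Complex.I * (J t).l₂ * x - (J t).e₂ * r
    let φ : ℝ → ℂ := fun r' => ρ ((J t).A * x, r')
    let hx : ℂ := Complex.I * ((J t).l₁ * r + (J t).c) - 2 * (J t).l₃ * x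
    let hr : ℂ := Complex.I * (J t).l₁ * x - 2 * (J t).e₁ * r
    let K₀ := gaussMoment 0 φ z m
    let K₁ := gaussMoment 1 φ z m
    let K₂ := gaussMoment 2 φ z m
    let K' := gaussMoment 0 (fun r' => fderiv ℝ ρ ((J t).A * x, r') (1, 0)) z m
    g.act ((J t).act ρ) x r = (√((J t).e₁ / Real.pi) : ℝ) *
      Complex.exp (Complex.I * ((J t).l₁ * x * r + (J t).c * x) - (J t).l₃ * x ^ 2
        - (J t).e₁ * r ^ 2) *
      (g.Lc * K₀
        + g.X 1 1 * ((hr ^ 2 - 2 * (J t).e₁) * K₀ - 2 * hr * (J t).e₂ * K₁ + (J t).e₂ ^ 2 * K₂)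
        + (x * g.Y 0 0 + r * g.Y 1 0) * (hx * K₀ + (J t).A * K' + Complex.I * (J t).l₂ * K₁)
        + (x * g.Y 0 1 + r * g.Y 1 1) * (hr * K₀ - (J t).e₂ * K₁)
        + (g.Z 0 0 * x ^ 2 + (g.Z 0 1 + g.Z 1 0) * x * r + g.Z 1 1 * r ^ 2) * K₀) := by
  intro m z φ hx hr K₀ K₁ K₂ K'
  have hm : 0 < m := by
    have := hJ.2.1
    have := sq_pos_of_ne_zero he₂
    positivity
  set N : ℂ := ((√((J t).e₁ / Real.pi) : ℝ) : ℂ) with hN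
  let E : ℝ → ℝ → ℂ := fun x r => Complex.exp (Complex.I * ((J t).l₁ * x * r + (J t).c * x)
    - (J t).l₃ * x ^ 2 - (J t).e₁ * r ^ 2)
  let M : ℕ → ℝ → ℝ → ℂ := fun n x r => gaussMoment n (fun r' => ρ ((J t).A * x, r'))
    (Complex.I * (J t).l₂ * x - (J t).e₂ * r) m
  have hact : (J t).act ρ = fun x r => N * E x r * M 0 x r := by
    ext x r
    exact FormI.act_apply hJ ρ x r
  have hEx : HasDerivAt (fun x : ℝ => E x r) (hx * E x r) x := by
    have h1 : HasDerivAt (fun y : ℝ => (y : ℂ)) 1 x := Complex.ofRealCLM.hasDerivAt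
    have h := (((((h1.const_mul ((J t).l₁ : ℂ)).mul_const (r : ℂ)).add
      (h1.const_mul ((J t).c : ℂ))).const_mul Complex.I).sub
      ((h1.pow 2).const_mul ((J t).l₃ : ℂ))).sub_const ((J t).e₁ * r ^ 2 : ℂ) |>.cexp
    refine h.congr_deriv ?_
    simp only [E, hx, Pi.add_apply, Pi.sub_apply, Pi.pow_apply]
    push_cast
    ring
  have hEr (r : ℝ) : HasDerivAt (fun r : ℝ => E x r)
      ((Complex.I * (J t).l₁ * x - 2 * (J t).e₁ * r) * E x r) r := by
    have h1 : HasDerivAt (fun y : ℝ => (y : ℂ)) 1 r := Complex.ofRealCLM.hasDerivAt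
    have h := (((((h1.const_mul ((J t).l₁ * x : ℂ)).add_const ((J t).c * x : ℂ)).const_mul
      Complex.I).sub_const ((J t).l₃ * x ^ 2 : ℂ)).sub
      ((h1.pow 2).const_mul ((J t).e₁ : ℂ))) |>.cexp
    refine h.congr_deriv ?_
    simp only [E, Pi.sub_apply, Pi.pow_apply]
    push_cast
    ring
  have hMx : HasDerivAt (fun x : ℝ => M 0 x r)
      ((J t).A * K' + Complex.I * (J t).l₂ * K₁) x :=
    hasDerivAt_gaussMoment_fst 0 ρ (J t).A m hm (Complex.I * (J t).l₂) (-((J t).e₂ * r)) x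
  have hMr (n : ℕ) (r : ℝ) : HasDerivAt (fun r : ℝ => M n x r) (-(J t).e₂ * M (n + 1) x r) r := by
    have h := hasDerivAt_gaussMoment_snd n ρ ((J t).A * x) m hm (-(J t).e₂)
      (Complex.I * (J t).l₂ * x) r
    have e (r : ℝ) : Complex.I * (J t).l₂ * x - (J t).e₂ * r
        = -((J t).e₂ : ℂ) * r + Complex.I * (J t).l₂ * x := by ring
    simp only [M, e]
    exact h
  have hd0 : pd 0 ((J t).act ρ) x r =
      N * E x r * (hx * K₀ + (J t).A * K' + Complex.I * (J t).l₂ * K₁) := by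
    rw [hact, pd_zero_apply]
    refine ((hEx.const_mul N).mul hMx).deriv.trans ?_
    simp only [M, K₀, φ, z]
    ring
  have hd1 (r : ℝ) : HasDerivAt (fun r => N * E x r * M 0 x r)
      (N * E x r * ((Complex.I * (J t).l₁ * x - 2 * (J t).e₁ * r) * M 0 x r
        - (J t).e₂ * M 1 x r)) r := by
    refine (((hEr r).const_mul N).mul (hMr 0 r)).congr_deriv ?_
    ring
  have hd11 : pd 1 (pd 1 ((J t).act ρ)) x r = N * E x r *
      ((hr ^ 2 - 2 * (J t).e₁) * K₀ - 2 * hr * (J t).e₂ * K₁ + (J t).e₂ ^ 2 * K₂) := by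
    have h1 : (fun r => pd 1 ((J t).act ρ) x r) = fun r => N * E x r *
        ((Complex.I * (J t).l₁ * x - 2 * (J t).e₁ * r) * M 0 x r - (J t).e₂ * M 1 x r) := by
      ext r
      rw [hact, pd_one_apply]
      exact (hd1 r).deriv
    rw [pd_one_apply, h1]
    have hlin := hasDerivAt_ofReal_affine (-2 * (J t).e₁) (Complex.I * (J t).l₁ * x) r
    have h2 := ((hEr r).const_mul N).mul
      ((hlin.mul (hMr 0 r)).sub ((hMr 1 r).const_mul ((J t).e₂ : ℂ)))
    have e : (fun r : ℝ => N * E x r *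
        ((Complex.I * (J t).l₁ * x - 2 * (J t).e₁ * r) * M 0 x r - (J t).e₂ * M 1 x r))
        = (fun r : ℝ => N * E x r) * ((fun r : ℝ => -2 * ((J t).e₁ : ℂ) * r
          + Complex.I * (J t).l₁ * x) * (fun r => M 0 x r) - fun r => (J t).e₂ * M 1 x r) := by
      ext r
      simp only [Pi.mul_apply, Pi.sub_apply]
      ring
    rw [e]
    refine h2.deriv.trans ?_
    simp only [Pi.mul_apply, Pi.sub_apply, M, K₀, K₁, K₂, φ, z, hr]
    ring
  have hd1' : pd 1 ((J t).act ρ) x r = N * E x r * (hr * K₀ - (J t).e₂ * K₁) := by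
    rw [hact, pd_one_apply]
    exact (hd1 r).deriv
  have hf : (J t).act ρ x r = N * E x r * K₀ := by rw [hact]
  simp only [QuadGenerator.act, Fin.sum_univ_two, hX.1, hX.2.1, hX.2.2, hd0, hd1', hd11, hf,
    Matrix.cons_val_zero, Matrix.cons_val_one, zero_mul, zero_add]
  ring

/-- The rate at which `c` fails to be proportional to `A`. -/
def FormI.defect (S : Set ℝ) (J : ℝ → FormI) (t : ℝ) : ℝ :=
  derivWithin (fun s => (J s).c) S t - (J t).c * derivWithin (fun s => (J s).A) S t / (J t).A

theorem FormI.NonsingularFamily.differentiableOn {S : Set ℝ} {J : ℝ → FormI}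
    (hJ : FormI.NonsingularFamily J S) :
    DifferentiableOn ℝ (fun t => (J t).A) S ∧ DifferentiableOn ℝ (fun t => (J t).c) S ∧
    DifferentiableOn ℝ (fun t => (J t).e₁) S ∧ DifferentiableOn ℝ (fun t => (J t).e₂) S ∧
    DifferentiableOn ℝ (fun t => (J t).l₁) S ∧ DifferentiableOn ℝ (fun t => (J t).l₂) S ∧
    DifferentiableOn ℝ (fun t => (J t).l₃) S := by
  obtain ⟨⟨ha1, ha2, ha3⟩, ⟨hb1, hb2, hb3, hb4⟩, ⟨hc1, hc2⟩, he1, he2⟩ :=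
    hJ.exponent.differentiableOn
  have hA : DifferentiableOn ℝ (fun t => (J t).A) S :=
    hJ.alpha.fun_div hJ.beta fun t ht => (hJ.tracePreserving t ht).1
  exact ⟨hA, hc1.fun_add (hA.fun_mul hc2), he1, he2, hb1.fun_add (hA.fun_mul hb3),
    hb2.fun_add (hA.fun_mul hb4),
    (ha1.fun_add (hA.fun_mul ha2)).fun_add ((hA.fun_pow 2).fun_mul ha3)⟩

theorem FormI.NonsingularFamily.ne_zero {S : Set ℝ} {J : ℝ → FormI}
    (hJ : FormI.NonsingularFamily J S) {t : ℝ} (ht : t ∈ S) :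
    (J t).A ≠ 0 ∧ (J t).e₁ ≠ 0 ∧ (J t).e₂ ≠ 0 := by
  have h := hJ.nonsingular t ht
  exact ⟨div_ne_zero (left_ne_zero_of_mul h) (hJ.tracePreserving t ht).1,
    (hJ.tracePreserving t ht).2.1.ne', right_ne_zero_of_mul h⟩

theorem sqrt_div_pi_deriv {a : ℝ} (ha : 0 < a) (d : ℝ) :
    d / Real.pi / (2 * √(a / Real.pi)) = √(a / Real.pi) * (d / (2 * a)) := by
  have hpos : 0 < √(a / Real.pi) := Real.sqrt_pos.2 (div_pos ha Real.pi_pos)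
  have hsq := Real.sq_sqrt (div_pos ha Real.pi_pos).le
  have hpi := Real.pi_ne_zero
  rw [div_eq_iff (by positivity)]
  calc d / Real.pi = a / Real.pi * (d / a) := by field_simp
    _ = √(a / Real.pi) ^ 2 * (d / a) := by rw [hsq]
    _ = _ := by
      generalize √(a / Real.pi) = s
      field_simp

/-- The coefficients of `K₀`, `K₁`, `K₂`, `K'` in the time derivative of the kernel agree with those
in its image under the generator. -/
theorem FormI.generator_identity {A e₁ e₂ : ℂ} (hA : A ≠ 0) (he₁ : e₁ ≠ 0) (he₂ : e₂ ≠ 0)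
    (l₁ l₂ l₃ c dA dc de₁ de₂ dl₁ dl₂ dl₃ K₀ K₁ K₂ K' x r : ℂ) :
    (de₁ / (2 * e₁) + Complex.I * (dl₁ * x * r + dc * x) - dl₃ * x ^ 2 - de₁ * r ^ 2) * K₀
      + (dA * x * K' + (Complex.I * dl₂ * x - de₂ * r) * K₁
        - (2 * e₂ * de₂ * (4 * e₁) - e₂ ^ 2 * (4 * de₁)) / (4 * e₁) ^ 2 * K₂) =
    (de₁ / e₁ - de₂ / e₂) * K₀
      + (de₁ / (4 * e₁ ^ 2) - de₂ / (2 * e₁ * e₂)) *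
        (((Complex.I * l₁ * x - 2 * e₁ * r) ^ 2 - 2 * e₁) * K₀
          - 2 * (Complex.I * l₁ * x - 2 * e₁ * r) * e₂ * K₁ + e₂ ^ 2 * K₂)
      + x * (dA / A) * ((Complex.I * (l₁ * r + c) - 2 * l₃ * x) * K₀ + A * K'
          + Complex.I * l₂ * K₁)
      + (x * (Complex.I * (l₁ * de₂ / (e₁ * e₂) + l₂ * dA / (e₂ * A) - l₁ * de₁ / (2 * e₁ ^ 2)
            - dl₂ / e₂)) + r * (de₁ / e₁ - de₂ / e₂)) *
          ((Complex.I * l₁ * x - 2 * e₁ * r) * K₀ - e₂ * K₁)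
      + ((l₁ ^ 2 / 2 * (de₂ / (e₁ * e₂) - de₁ / (2 * e₁ ^ 2)) + l₁ / e₂ * (l₂ * dA / A - dl₂)
            + 2 * l₃ * dA / A - dl₃) * x ^ 2
          + 2 * Complex.I * (dA / A * (e₁ * l₂ / e₂ - l₁ / 2) + dl₁ / 2 - dl₂ * e₁ / e₂
            + l₁ / 2 * (de₂ / e₂ - de₁ / e₁)) * x * r) * K₀
      + Complex.I * (dc - c * dA / A) * x * K₀ := by
  field_simp
  ring_nf
  simp only [Complex.I_sq]
  ring

/-- The images under `J_I` satisfy `∂_t ρ = L ρ + i (c' - c A' / A) x ρ`. -/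
theorem FormI.hasDerivWithinAt_act {S : Set ℝ} {J : ℝ → FormI}
    (hJ : FormI.NonsingularFamily J S) (ρ : 𝓢(ℝ × ℝ, ℂ)) {t : ℝ} (ht : t ∈ S) (x r : ℝ) :
    HasDerivWithinAt (fun s => (J s).act ρ x r)
      ((FormI.generator S J t).act ((J t).act ρ) x r
        + Complex.I * FormI.defect S J t * x * (J t).act ρ x r) S t := by
  obtain ⟨dA, dc, de₁, de₂, dl₁, dl₂, dl₃⟩ := hJ.differentiableOn
  obtain ⟨hA0, he₁0, he₂0⟩ := hJ.ne_zero ht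
  have hTP := hJ.tracePreserving t ht
  have hA := (dA t ht).hasDerivWithinAt
  have hc := (dc t ht).hasDerivWithinAt
  have he₁ := (de₁ t ht).hasDerivWithinAt
  have he₂ := (de₂ t ht).hasDerivWithinAt
  have hl₁ := (dl₁ t ht).hasDerivWithinAt
  have hl₂ := (dl₂ t ht).hasDerivWithinAt
  have hl₃ := (dl₃ t ht).hasDerivWithinAt
  have hm : 0 < (J t).e₂ ^ 2 / (4 * (J t).e₁) := by
    have := hTP.2.1
    have := sq_pos_of_ne_zero he₂0
    positivity
  have hN := (((he₁.div_const Real.pi).sqrt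
    (div_ne_zero he₁0 Real.pi_ne_zero))).ofReal_comp
  have hE := (((((hl₁.ofReal_comp.mul_const (x : ℂ)).mul_const (r : ℂ)).add
    (hc.ofReal_comp.mul_const (x : ℂ))).const_mul Complex.I).sub
    (hl₃.ofReal_comp.mul_const ((x : ℂ) ^ 2))).sub
    (he₁.ofReal_comp.mul_const ((r : ℂ) ^ 2)) |>.cexp
  have hM := hasDerivWithinAt_gaussMoment 0 ρ (hA.mul_const x)
    (((hl₂.ofReal_comp.const_mul Complex.I).mul_const (x : ℂ)).sub
      (he₂.ofReal_comp.mul_const (r : ℂ)))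
    ((he₂.fun_pow 2).fun_div (he₁.const_mul 4) (mul_ne_zero four_ne_zero he₁0)) hm
  have h := (hN.mul hE).mul hM
  refine (h.congr (fun s hs => FormI.act_apply (hJ.tracePreserving s hs) ρ x r)
    (FormI.act_apply hTP ρ x r)).congr_deriv ?_
  rw [FormI.generator_act hTP he₂0 ρ x r _ (by simp [FormI.generator]), FormI.act_apply hTP]
  simp only [FormI.generator, Matrix.of_apply, Matrix.cons_val', Matrix.cons_val_zero,
    Matrix.cons_val_one, Matrix.cons_val_fin_one, FormI.defect, Pi.mul_apply, Pi.sub_apply,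
    Pi.add_apply, sqrt_div_pi_deriv hTP.2.1,
    Nat.add_one_sub_one, pow_one, zero_add, Nat.cast_ofNat]
  have hA0' : ((J t).A : ℂ) ≠ 0 := by exact_mod_cast hA0
  have he₁0' : ((J t).e₁ : ℂ) ≠ 0 := by exact_mod_cast he₁0
  have he₂0' : ((J t).e₂ : ℂ) ≠ 0 := by exact_mod_cast he₂0
  have key := FormI.generator_identity hA0' he₁0' he₂0' (J t).l₁ (J t).l₂ (J t).l₃ (J t).c
    (derivWithin (fun s => (J s).A) S t : ℝ) (derivWithin (fun s => (J s).c) S t : ℝ)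
    (derivWithin (fun s => (J s).e₁) S t : ℝ) (derivWithin (fun s => (J s).e₂) S t : ℝ)
    (derivWithin (fun s => (J s).l₁) S t : ℝ) (derivWithin (fun s => (J s).l₂) S t : ℝ)
    (derivWithin (fun s => (J s).l₃) S t : ℝ)
    (gaussMoment 0 (fun r' => ρ ((J t).A * x, r')) (Complex.I * (J t).l₂ * x - (J t).e₂ * r)
        ((J t).e₂ ^ 2 / (4 * (J t).e₁)))
    (gaussMoment 1 (fun r' => ρ ((J t).A * x, r')) (Complex.I * (J t).l₂ * x - (J t).e₂ * r)
        ((J t).e₂ ^ 2 / (4 * (J t).e₁)))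
    (gaussMoment 2 (fun r' => ρ ((J t).A * x, r')) (Complex.I * (J t).l₂ * x - (J t).e₂ * r)
        ((J t).e₂ ^ 2 / (4 * (J t).e₁)))
    (gaussMoment 0 (fun r' => fderiv ℝ ρ ((J t).A * x, r') (1, 0))
      (Complex.I * (J t).l₂ * x - (J t).e₂ * r) ((J t).e₂ ^ 2 / (4 * (J t).e₁))) x r
  push_cast at key ⊢
  linear_combination (((√((J t).e₁ / Real.pi) : ℝ) : ℂ) *
    Complex.exp (Complex.I * ((J t).l₁ * x * r + (J t).c * x) - (J t).l₃ * x ^ 2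
        - (J t).e₁ * r ^ 2)) * key

/-- Coherent states are mapped to Gaussian kernels whose linear coefficients are
`i c - i A p + 4 i l₂ s q` and `-4 e₂ s q`, `s = 1 / (4 (1 + e₃))`. -/
theorem FormI.act_gaussian {J : FormI} (hJ : J.TracePreserving) :
    let s : ℝ := 1 / (4 * (1 + J.e₂ ^ 2 / (4 * J.e₁)))
    ∃ u v w : ℂ, ∀ p q : ℝ, ∃ ρ : 𝓢(ℝ × ℝ, ℂ), IsState ρ ∧ ∃ C : ℂ, C ≠ 0 ∧
      J.act ρ = gaussKernel C u v w
        (Complex.I * J.c + (-Complex.I * J.A) * p + (4 * Complex.I * J.l₂ * s) * q)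
        ((-4 * J.e₂ * s) * q) := by
  intro s
  have he := hJ.2.1
  set m := J.e₂ ^ 2 / (4 * J.e₁) with hm
  have hm0 : 0 ≤ m := by positivity
  refine ⟨-J.l₃ - J.A ^ 2 / 4 - J.l₂ ^ 2 * s, Complex.I * J.l₁ - 2 * Complex.I * J.l₂ * J.e₂ * s,
    -J.e₁ + J.e₂ ^ 2 * s, fun p q => ?_⟩
  obtain ⟨ρ, hρ, hf⟩ := exists_gaussian_isState one_pos p q
  refine ⟨ρ, hρ, (√(J.e₁ / Real.pi) : ℝ) * ((√(1 / Real.pi) : ℝ) *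
    ((Real.pi / (1 + m : ℝ) : ℂ) ^ (1 / 2 : ℂ) * Complex.exp (4 * q ^ 2 * s - q ^ 2))), ?_, ?_⟩
  · have h1 : √(J.e₁ / Real.pi) ≠ 0 := (Real.sqrt_pos.2 (by positivity)).ne'
    have h2 : √(1 / Real.pi) ≠ 0 := (Real.sqrt_pos.2 (by positivity)).ne'
    have h3 : (Real.pi / (1 + m : ℝ) : ℂ) ≠ 0 := by
      have : Real.pi / (1 + m) ≠ 0 := by positivity
      exact_mod_cast this
    refine mul_ne_zero (by exact_mod_cast h1) (mul_ne_zero (by exact_mod_cast h2)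
      (mul_ne_zero ?_ (Complex.exp_ne_zero _)))
    rw [Complex.cpow_def_of_ne_zero h3]
    exact Complex.exp_ne_zero _
  · ext x r
    rw [FormI.act_apply hJ, gaussMoment, gaussKernel]
    have hint : ∀ r' : ℝ, (r' : ℂ) ^ 0 * Complex.exp ((Complex.I * J.l₂ * x - J.e₂ * r) * r'
        - m * r' ^ 2) * ρ (J.A * x, r') = (√(1 / Real.pi) : ℝ) *
        Complex.exp (((-(1 + m) : ℝ) : ℂ) * r' ^ 2
          + (Complex.I * J.l₂ * x - J.e₂ * r + 2 * q) * r' +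
          (-q ^ 2 - (J.A * x) ^ 2 / 4 - Complex.I * p * (J.A * x))) := by
      intro r'
      rw [hf, pow_zero, one_mul, mul_left_comm, ← Complex.exp_add]
      congr 2
      push_cast
      ring
    simp only [← hm, hint]
    rw [integral_const_mul, integral_cexp_quadratic (by
      rw [Complex.ofReal_re]
      linarith)]
    have hs : ∀ Q : ℂ, Q / (4 * ((-(1 + m) : ℝ) : ℂ)) = -(Q * s) := by
      intro Q
      have hsm : s = 1 / (4 * (1 + m)) := rfl
      rw [hsm]
      have : (1 + m : ℂ) ≠ 0 := by
        have : (1 + m : ℝ) ≠ 0 := by positivity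
        exact_mod_cast this
      push_cast
      generalize (m : ℂ) = m' at this
      field_simp
    have hneg : -((-(1 + m) : ℝ) : ℂ) = ((1 + m : ℝ) : ℂ) := by push_cast; ring
    rw [hs, hneg]
    have hexp : Complex.exp (Complex.I * (J.l₁ * x * r + J.c * x) - J.l₃ * x ^ 2 - J.e₁ * r ^ 2) *
        Complex.exp (-q ^ 2 - (J.A * x) ^ 2 / 4 - Complex.I * p * (J.A * x)
          - -((Complex.I * J.l₂ * x - J.e₂ * r + 2 * q) ^ 2 * s)) =
        Complex.exp (4 * q ^ 2 * s - q ^ 2) *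
        Complex.exp ((-J.l₃ - J.A ^ 2 / 4 - J.l₂ ^ 2 * s) * x ^ 2
          + (Complex.I * J.l₁ - 2 * Complex.I * J.l₂ * J.e₂ * s) * x * r
          + (-J.e₁ + J.e₂ ^ 2 * s) * r ^ 2
          + (Complex.I * J.c + (-Complex.I * J.A) * p + (4 * Complex.I * J.l₂ * s) * q) * x
          + ((-4 * J.e₂ * s) * q) * r) := by
      rw [← Complex.exp_add, ← Complex.exp_add]
      congr 1
      linear_combination (J.l₂ * x : ℂ) ^ 2 * s * Complex.I_sq
    linear_combination ((√(J.e₁ / Real.pi) : ℝ) * ((√(1 / Real.pi) : ℝ) *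
      ((Real.pi / (1 + m : ℝ) : ℂ) ^ (1 / 2 : ℂ))) : ℂ) * hexp

/-! ### Operations with two delta factors -/

/-- `λ₃ = a₁ + A a₂ + A² a₃`. -/
def FormII.l₃ (J : FormII) : ℝ := J.a₁ + J.A * J.a₂ + J.A ^ 2 * J.a₃

theorem FormII.act_apply {J : FormII} (hJ : J.TracePreserving) (hη : J.η ≠ 0)
    (ρ : 𝓢(ℝ × ℝ, ℂ)) (x r : ℝ) :
    J.act ρ x r = (|J.B| : ℝ) *
      Complex.exp (Complex.I * (J.l * x * r + J.c * x) - J.l₃ * x ^ 2) *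
      ρ (J.A * x, J.B * r) := by
  obtain ⟨hβ, hγ, h1, h2⟩ := hJ
  have hx : J.α * x / J.β = J.A * x := by
    unfold FormII.A
    ring
  have hr : J.γ * r / J.η = J.B * r := by
    unfold FormII.B
    ring
  have hnorm : (J.norm : ℂ) * ((1 / (|J.β| * |J.η|) : ℝ) : ℂ) = (|J.B| : ℝ) := by
    rw [← Complex.ofReal_mul]
    congr 1
    have : |J.β| ≠ 0 := abs_ne_zero.2 hβ
    rw [FormII.norm, FormII.B, abs_mul, abs_div]
    field_simp
  -- the trace conditions remove the terms in `r²` and `r`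
  have hrr : J.e₁ + J.e₂ * J.B + J.e₃ * J.B ^ 2 = 0 := by
    have : J.e₁ + J.e₂ * J.B + J.e₃ * J.B ^ 2
        = (J.γ / J.η) ^ 2 * (J.e₁ * (J.η / J.γ) ^ 2 + J.e₂ * (J.η / J.γ) + J.e₃) := by
      unfold FormII.B
      field_simp
    rw [this, h1, mul_zero]
  have hr1 : J.d₁ + J.d₂ * J.B = 0 := by
    have : J.d₁ + J.d₂ * J.B = J.γ / J.η * (J.d₁ * (J.η / J.γ) + J.d₂) := by
      unfold FormII.B
      field_simp
    rw [this, h2, mul_zero]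
  rw [FormII.act, hnorm, mul_assoc, hx, hr]
  congr 3
  have hrr' : (J.e₁ + J.e₂ * J.B + J.e₃ * J.B ^ 2 : ℂ) = 0 := by exact_mod_cast hrr
  have hr1' : (J.d₁ + J.d₂ * J.B : ℂ) = 0 := by exact_mod_cast hr1
  simp only [Exponent.eval, FormII.l, FormII.l₃, FormII.c]
  push_cast
  linear_combination (-(r : ℂ) ^ 2) * hrr' - r * hr1'

theorem hasDerivWithinAt_schwartzMap_curve (φ : 𝓢(ℝ × ℝ, ℂ)) {y w : ℝ → ℝ} {y' w' : ℝ}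
    {S : Set ℝ} {t : ℝ} (hy : HasDerivWithinAt y y' S t) (hw : HasDerivWithinAt w w' S t) :
    HasDerivWithinAt (fun s => φ (y s, w s))
      (y' * fderiv ℝ φ (y t, w t) (1, 0) + w' * fderiv ℝ φ (y t, w t) (0, 1)) S t := by
  have h := (φ.differentiableAt (x := (y t, w t))).hasFDerivAt.comp_hasDerivWithinAt
    (f := fun s => (y s, w s)) t (hy.prodMk hw)
  refine h.congr_deriv ?_
  have : ((y', w') : ℝ × ℝ) = y' • (1, 0) + w' • (0, 1) := by simp
  rw [this, map_add, map_smul, map_smul, Complex.real_smul, Complex.real_smul]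

theorem FormII.generator_act {J : FormII} (hJ : J.TracePreserving)
    (hη : J.η ≠ 0) (ρ : 𝓢(ℝ × ℝ, ℂ)) (x r : ℝ) (g : QuadGenerator) (hX : g.X = 0) :
    g.act (J.act ρ) x r = (|J.B| : ℝ) *
      Complex.exp (Complex.I * (J.l * x * r + J.c * x) - J.l₃ * x ^ 2) *
      ((g.Lc + (g.Z 0 0 * x ^ 2 + (g.Z 0 1 + g.Z 1 0) * x * r + g.Z 1 1 * r ^ 2)) *
          ρ (J.A * x, J.B * r)
        + (x * g.Y 0 0 + r * g.Y 1 0) *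
          ((Complex.I * (J.l * r + J.c) - 2 * J.l₃ * x) * ρ (J.A * x, J.B * r)
            + J.A * fderiv ℝ ρ (J.A * x, J.B * r) (1, 0))
        + (x * g.Y 0 1 + r * g.Y 1 1) * (Complex.I * J.l * x * ρ (J.A * x, J.B * r)
            + J.B * fderiv ℝ ρ (J.A * x, J.B * r) (0, 1))) := by
  have hact : J.act ρ = fun x r : ℝ => (|J.B| : ℝ) *
      Complex.exp (Complex.I * (J.l * x * r + J.c * x) - J.l₃ * x ^ 2) *
      ρ (J.A * x, J.B * r) := by
    ext x r
    exact FormII.act_apply hJ hη ρ x r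
  have hd0 : pd 0 (J.act ρ) x r = (|J.B| : ℝ) *
      Complex.exp (Complex.I * (J.l * x * r + J.c * x) - J.l₃ * x ^ 2) *
      ((Complex.I * (J.l * r + J.c) - 2 * J.l₃ * x) * ρ (J.A * x, J.B * r)
            + J.A * fderiv ℝ ρ (J.A * x, J.B * r) (1, 0)) := by
    rw [hact, pd_zero_apply]
    have h1 : HasDerivAt (fun y : ℝ => (y : ℂ)) 1 x := Complex.ofRealCLM.hasDerivAt
    have hE := (((((h1.const_mul (J.l : ℂ)).mul_const (r : ℂ)).add
      (h1.const_mul (J.c : ℂ))).const_mul Complex.I).sub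
      ((h1.pow 2).const_mul (J.l₃ : ℂ))) |>.cexp
    have hy : HasDerivAt (fun x : ℝ => J.A * x) J.A x := by
      simpa using (hasDerivAt_id x).const_mul J.A
    have hρ := hasDerivWithinAt_schwartzMap_curve ρ (S := univ) hy.hasDerivWithinAt
      (hasDerivAt_const x (J.B * r)).hasDerivWithinAt
    rw [hasDerivWithinAt_univ] at hρ
    refine ((hE.const_mul ((|J.B| : ℝ) : ℂ)).mul hρ).deriv.trans ?_
    simp only [Pi.add_apply, Pi.sub_apply, Pi.pow_apply]
    push_cast
    ring
  have hd1 : pd 1 (J.act ρ) x r = (|J.B| : ℝ) *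
      Complex.exp (Complex.I * (J.l * x * r + J.c * x) - J.l₃ * x ^ 2) *
      (Complex.I * J.l * x * ρ (J.A * x, J.B * r)
            + J.B * fderiv ℝ ρ (J.A * x, J.B * r) (0, 1)) := by
    rw [hact, pd_one_apply]
    have h1 : HasDerivAt (fun y : ℝ => (y : ℂ)) 1 r := Complex.ofRealCLM.hasDerivAt
    have hE := ((((h1.const_mul (J.l * x : ℂ)).add_const (J.c * x : ℂ)).const_mul
      Complex.I).sub_const (J.l₃ * x ^ 2 : ℂ)) |>.cexp
    have hy : HasDerivAt (fun x : ℝ => J.B * x) J.B r := by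
      simpa using (hasDerivAt_id r).const_mul J.B
    have hρ := hasDerivWithinAt_schwartzMap_curve ρ (S := univ)
      (hasDerivAt_const r (J.A * x)).hasDerivWithinAt hy.hasDerivWithinAt
    rw [hasDerivWithinAt_univ] at hρ
    refine ((hE.const_mul ((|J.B| : ℝ) : ℂ)).mul hρ).deriv.trans ?_
    push_cast
    ring
  have hf : J.act ρ x r = (|J.B| : ℝ) *
      Complex.exp (Complex.I * (J.l * x * r + J.c * x) - J.l₃ * x ^ 2) *
      ρ (J.A * x, J.B * r) := by rw [hact]
  simp only [QuadGenerator.act, Fin.sum_univ_two, hX, hd0, hd1, hf,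
    Matrix.cons_val_zero, Matrix.cons_val_one, Matrix.zero_apply, zero_mul, add_zero]
  ring

/-- The rate at which `c` fails to be proportional to `A`. -/
def FormII.defect (S : Set ℝ) (J : ℝ → FormII) (t : ℝ) : ℝ :=
  derivWithin (fun s => (J s).c) S t - (J t).c * derivWithin (fun s => (J s).A) S t / (J t).A

theorem FormII.NonsingularFamily.differentiableOn {S : Set ℝ} {J : ℝ → FormII}
    (hJ : FormII.NonsingularFamily J S) :
    DifferentiableOn ℝ (fun t => (J t).A) S ∧ DifferentiableOn ℝ (fun t => (J t).c) S ∧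
    DifferentiableOn ℝ (fun t => (J t).B) S ∧ DifferentiableOn ℝ (fun t => (J t).l) S := by
  obtain ⟨-, ⟨hb1, hb2, hb3, hb4⟩, ⟨hc1, hc2⟩, -, -⟩ := hJ.exponent.differentiableOn
  have hA : DifferentiableOn ℝ (fun t => (J t).A) S :=
    hJ.alpha.fun_div hJ.beta fun t ht => (hJ.tracePreserving t ht).1
  have hB : DifferentiableOn ℝ (fun t => (J t).B) S :=
    hJ.gamma.fun_div hJ.eta fun t ht => right_ne_zero_of_mul (hJ.nonsingular t ht)
  exact ⟨hA, hc1.fun_add (hA.fun_mul hc2), hB, (hb1.fun_add (hA.fun_mul hb3)).fun_add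
    (hB.fun_mul (hb2.fun_add (hA.fun_mul hb4)))⟩

theorem FormII.NonsingularFamily.ne_zero {S : Set ℝ} {J : ℝ → FormII}
    (hJ : FormII.NonsingularFamily J S) {t : ℝ} (ht : t ∈ S) :
    (J t).A ≠ 0 ∧ (J t).B ≠ 0 ∧ (J t).η ≠ 0 := by
  have h := hJ.nonsingular t ht
  exact ⟨div_ne_zero (left_ne_zero_of_mul h) (hJ.tracePreserving t ht).1,
    div_ne_zero (hJ.tracePreserving t ht).2.1 (right_ne_zero_of_mul h), right_ne_zero_of_mul h⟩

/-- The images under `J_II` satisfy `∂_t ρ = L ρ + i (c' - c A' / A) x ρ`. -/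
theorem FormII.hasDerivWithinAt_act {S : Set ℝ} {J : ℝ → FormII}
    (hJ : FormII.NonsingularFamily J S) (ρ : 𝓢(ℝ × ℝ, ℂ)) {t : ℝ} (ht : t ∈ S) (x r : ℝ) :
    HasDerivWithinAt (fun s => (J s).act ρ x r)
      ((FormII.generator S J t).act ((J t).act ρ) x r
        + Complex.I * FormII.defect S J t * x * (J t).act ρ x r) S t := by
  obtain ⟨dA, dc, dB, dl⟩ := hJ.differentiableOn
  obtain ⟨⟨da₁, da₂, da₃⟩, -⟩ := hJ.exponent.differentiableOn
  obtain ⟨hA0, hB0, hη⟩ := hJ.ne_zero ht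
  have hTP := hJ.tracePreserving t ht
  have hA := (dA t ht).hasDerivWithinAt
  have hc := (dc t ht).hasDerivWithinAt
  have hB := (dB t ht).hasDerivWithinAt
  have hl := (dl t ht).hasDerivWithinAt
  have hl₃ := ((da₁ t ht).hasDerivWithinAt.fun_add (hA.fun_mul (da₂ t ht).hasDerivWithinAt)).fun_add
    ((hA.fun_pow 2).fun_mul (da₃ t ht).hasDerivWithinAt)
  have hN := ((hasDerivAt_abs hB0).comp_hasDerivWithinAt t hB).ofReal_comp
  have hE := ((((hl.ofReal_comp.mul_const (x : ℂ)).mul_const (r : ℂ)).add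
    (hc.ofReal_comp.mul_const (x : ℂ))).const_mul Complex.I).sub
    (hl₃.ofReal_comp.mul_const ((x : ℂ) ^ 2)) |>.cexp
  have hM := hasDerivWithinAt_schwartzMap_curve ρ (hA.mul_const x) (hB.mul_const r)
  have h := (hN.mul hE).mul hM
  refine (h.congr (fun s hs => FormII.act_apply (hJ.tracePreserving s hs) (hJ.ne_zero hs).2.2 ρ x r)
    (FormII.act_apply hTP hη ρ x r)).congr_deriv ?_
  rw [FormII.generator_act hTP hη ρ x r _ (by simp [FormII.generator]),
    FormII.act_apply hTP hη]
  have hsign : ((SignType.sign (J t).B : ℝ) : ℂ) = (|(J t).B| : ℝ) / (J t).B := by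
    have hB0' : ((J t).B : ℂ) ≠ 0 := by exact_mod_cast hB0
    rw [eq_div_iff hB0']
    exact_mod_cast sign_mul_self (J t).B
  have hA0' : ((J t).A : ℂ) ≠ 0 := by exact_mod_cast hA0
  have hB0' : ((J t).B : ℂ) ≠ 0 := by exact_mod_cast hB0
  simp only [FormII.generator, Matrix.of_apply, Matrix.cons_val', Matrix.cons_val_zero,
    Matrix.cons_val_one, Matrix.cons_val_fin_one, FormII.defect, Pi.mul_apply, Pi.sub_apply,
    Pi.add_apply, Function.comp_apply, Nat.add_one_sub_one, pow_one, Nat.cast_ofNat]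
  push_cast
  rw [hsign]
  simp only [FormII.l₃]
  push_cast
  generalize Complex.exp _ = E
  generalize ((|(J t).B| : ℝ) : ℂ) = N
  field_simp
  ring

/-- Coherent states are mapped to Gaussian kernels whose linear coefficients are `i c - i A p` and
`2 B q`. -/
theorem FormII.act_gaussian {J : FormII} (hJ : J.TracePreserving) (hη : J.η ≠ 0) :
    ∃ u v w : ℂ, ∀ p q : ℝ, ∃ ρ : 𝓢(ℝ × ℝ, ℂ), IsState ρ ∧ ∃ C : ℂ, C ≠ 0 ∧
      J.act ρ = gaussKernel C u v w
        (Complex.I * J.c + (-Complex.I * J.A) * p + 0 * q) ((2 * J.B) * q) := by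
  refine ⟨-J.l₃ - J.A ^ 2 / 4, Complex.I * J.l, -J.B ^ 2, fun p q => ?_⟩
  obtain ⟨ρ, hρ, hf⟩ := exists_gaussian_isState one_pos p q
  refine ⟨ρ, hρ, (|J.B| : ℝ) * ((√(1 / Real.pi) : ℝ) * Complex.exp (-q ^ 2)), ?_, ?_⟩
  · have h1 : |J.B| ≠ 0 := abs_ne_zero.2 (div_ne_zero hJ.2.1 hη)
    have h2 : √(1 / Real.pi) ≠ 0 := (Real.sqrt_pos.2 (by positivity)).ne'
    exact mul_ne_zero (by exact_mod_cast h1) (mul_ne_zero (by exact_mod_cast h2)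
      (Complex.exp_ne_zero _))
  · ext x r
    rw [FormII.act_apply hJ hη, gaussKernel, hf]
    have hexp : Complex.exp (Complex.I * (J.l * x * r + J.c * x) - J.l₃ * x ^ 2) *
        Complex.exp (-(1 : ℝ) * ((J.B * r : ℝ) - q) ^ 2 - (1 : ℝ) / 4 * (J.A * x : ℝ) ^ 2
          - Complex.I * p * (J.A * x : ℝ)) =
        Complex.exp (-q ^ 2) * Complex.exp ((-J.l₃ - J.A ^ 2 / 4) * x ^ 2
          + (Complex.I * J.l) * x * r + (-J.B ^ 2) * r ^ 2
          + (Complex.I * J.c + (-Complex.I * J.A) * p + 0 * q) * x + ((2 * J.B) * q) * r) := by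
      rw [← Complex.exp_add, ← Complex.exp_add]
      congr 1
      push_cast
      ring
    linear_combination (((|J.B| : ℝ) : ℂ) * (√(1 / Real.pi) : ℝ)) * hexp

/-! ### Singular operations of the form `J_I` -/

/-- If `α = 0` the output depends only on the position density `ρ(0, ·)` of the input; if `e₂ = 0`
the output density does not depend on the input. Both fail to be close to the identity: a momentum
translate of a state has the same density, a position translate has another one. -/
theorem FormI.not_startsFromIdentity {t₁ : ℝ} (ht₁ : 0 < t₁) {J : ℝ → FormI}
    (hJ : ∀ t ∈ Ioo 0 t₁, (J t).TracePreserving ∧ (J t).α * (J t).e₂ = 0) :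
    ¬ StartsFromIdentity fun t => (J t).act := by
  intro h
  obtain ⟨ρ₁, hρ₁, hf₁⟩ := exists_gaussian_isState one_pos 0 0
  obtain ⟨ρ₂, hρ₂, hf₂⟩ := exists_gaussian_isState one_pos Real.pi 0
  obtain ⟨ρ₃, hρ₃, hf₃⟩ := exists_gaussian_isState one_pos 0 1
  have hlim := ((h ρ₁ hρ₁ 1 0).sub (h ρ₂ hρ₂ 1 0)).mul ((h ρ₁ hρ₁ 0 0).sub (h ρ₃ hρ₃ 0 0))
  have hzero : ∀ᶠ t in 𝓝[>] (0 : ℝ), 0 = ((J t).act ρ₁ 1 0 - (J t).act ρ₂ 1 0) *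
      ((J t).act ρ₁ 0 0 - (J t).act ρ₃ 0 0) := by
    filter_upwards [Ioo_mem_nhdsGT ht₁] with t ht
    obtain ⟨hTP, hsing⟩ := hJ t ht
    rcases mul_eq_zero.1 hsing with hα | he
    · have : (J t).act ρ₁ 1 0 = (J t).act ρ₂ 1 0 := by
        simp [FormI.act, hα, hf₁, hf₂]
      rw [this, sub_self, zero_mul]
    · have key (ρ : 𝓢(ℝ × ℝ, ℂ)) (hρ : IsState ρ) :
          (J t).act ρ 0 0 = (√((J t).e₁ / Real.pi) : ℝ) := by
        rw [FormI.act_apply hTP]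
        simp [gaussMoment, he, hρ.2]
      rw [key ρ₁ hρ₁, key ρ₃ hρ₃, sub_self, mul_zero]
  have h0 := tendsto_nhds_unique (tendsto_const_nhds.congr' hzero) hlim
  have hc : ((√(1 / Real.pi) : ℝ) : ℂ) ≠ 0 := by
    have : √(1 / Real.pi) ≠ 0 := (Real.sqrt_pos.2 (by positivity)).ne'
    exact_mod_cast this
  rcases mul_eq_zero.1 h0.symm with h1 | h1 <;> rw [sub_eq_zero] at h1
  · rw [hf₁, hf₂] at h1
    have h2 := mul_left_cancel₀ hc h1
    have e : (-((1 : ℝ) : ℂ) * ((0 : ℝ) - (0 : ℝ)) ^ 2 - ((1 : ℝ) : ℂ) / 4 * (1 : ℝ) ^ 2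
        - Complex.I * Real.pi * (1 : ℝ)) = -(1 / 4) - Real.pi * Complex.I := by
      push_cast
      ring
    have e' : (-((1 : ℝ) : ℂ) * ((0 : ℝ) - (0 : ℝ)) ^ 2 - ((1 : ℝ) : ℂ) / 4 * (1 : ℝ) ^ 2
        - Complex.I * (0 : ℝ) * (1 : ℝ)) = -(1 / 4) := by
      push_cast
      ring
    rw [e, e', Complex.exp_sub, Complex.exp_pi_mul_I, div_neg, div_one, self_eq_neg] at h2
    exact Complex.exp_ne_zero _ h2
  · rw [hf₁, hf₃] at h1
    have h2 := mul_left_cancel₀ hc h1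
    have h3 := congrArg (fun z : ℂ => ‖z‖) h2
    norm_num [Complex.norm_exp] at h3
    exact absurd h3.symm (Real.exp_lt_one_iff.2 (by norm_num)).ne

/-! ### Singular Gaussian channels -/

theorem charFun_gaussian {σ : ℝ} (hσ : 0 < σ) {ρ : 𝓢(ℝ × ℝ, ℂ)}
    (hf : ∀ x r : ℝ, ρ (x, r) = (√(σ / Real.pi) : ℝ) *
      Complex.exp (-σ * (r - (0 : ℝ)) ^ 2 - σ / 4 * x ^ 2 - Complex.I * (0 : ℝ) * x))
    (k : Fin 2 → ℝ) :
    charFun ρ k = Complex.exp ((-(k 0 ^ 2 / (4 * σ) + σ / 4 * k 1 ^ 2) : ℝ) : ℂ) := by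
  have hint : ∀ r : ℝ, Complex.exp (Complex.I * ((k 0 * r : ℝ) : ℂ)) * ρ (-(k 1), r) =
      (√(σ / Real.pi) : ℝ) * Complex.exp (((-σ : ℝ) : ℂ) * r ^ 2 + (Complex.I * k 0) * r +
        (-(σ / 4 * k 1 ^ 2))) := by
    intro r
    rw [hf, mul_left_comm, ← Complex.exp_add]
    congr 2
    push_cast
    ring
  have hσ' : (σ : ℂ) ≠ 0 := by exact_mod_cast hσ.ne'
  simp only [charFun, hint]
  rw [integral_const_mul, integral_cexp_quadratic (by simpa using hσ), ← mul_assoc]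
  have hone : ((√(σ / Real.pi) : ℝ) : ℂ) * ((Real.pi : ℂ) / -((-σ : ℝ) : ℂ)) ^ (1 / 2 : ℂ) = 1 := by
    have h1 : ((Real.pi : ℂ) / -((-σ : ℝ) : ℂ)) = ((Real.pi / σ : ℝ) : ℂ) := by
      push_cast
      rw [neg_neg]
    have h2 : (1 / 2 : ℂ) = ((1 / 2 : ℝ) : ℂ) := by push_cast; rfl
    rw [h1, h2, ← Complex.ofReal_cpow (by positivity), ← Real.sqrt_eq_rpow, ← Complex.ofReal_mul,
      ← Real.sqrt_mul (by positivity)]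
    have : σ / Real.pi * (Real.pi / σ) = 1 := by field_simp
    rw [this, Real.sqrt_one, Complex.ofReal_one]
  rw [hone, one_mul]
  congr 1
  push_cast
  field_simp
  linear_combination (k 0 : ℂ) ^ 2 * Complex.I_sq

/-- Absolute value of the output of a Gaussian channel on a centred Gaussian state with covariance
matrix `diag (1 / (2σ), σ / 2)`: here `V, W, U` are the entries of the output covariance
`T diag (1 / (2σ), σ / 2) Tᵀ + N`, and the width in `x` is given by its Schur complement. -/
theorem GaussianTuple.norm_act_gaussian (G : GaussianTuple) {σ : ℝ} (hσ : 0 < σ) {ρ : 𝓢(ℝ × ℝ, ℂ)}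
    (hf : ∀ x r : ℝ, ρ (x, r) = (√(σ / Real.pi) : ℝ) *
      Complex.exp (-σ * (r - (0 : ℝ)) ^ 2 - σ / 4 * x ^ 2 - Complex.I * (0 : ℝ) * x))
    {V W U : ℝ} (hV : 0 < V)
    (hVe : V = G.T 0 0 ^ 2 / (2 * σ) + σ / 2 * G.T 0 1 ^ 2 + G.N 0 0)
    (hWe : W = G.T 0 0 * G.T 1 0 / (2 * σ) + σ / 2 * (G.T 0 1 * G.T 1 1)
      + (G.N 0 1 + G.N 1 0) / 2)
    (hUe : U = G.T 1 0 ^ 2 / (2 * σ) + σ / 2 * G.T 1 1 ^ 2 + G.N 1 1) :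
    ∃ C : ℝ, 0 < C ∧ ∀ x r : ℝ, ‖G.act ρ x r‖ =
      C * Real.exp (-((U - W ^ 2 / V) / 2 * x ^ 2) - (r - G.τ 0) ^ 2 / (2 * V)) := by
  have hpi := Real.pi_pos
  have hbase : ((Real.pi : ℂ) / -((-(V / 2) : ℝ) : ℂ)) ^ (1 / 2 : ℂ) ≠ 0 := by
    have h3 : ((Real.pi : ℂ) / -((-(V / 2) : ℝ) : ℂ)) ≠ 0 := by
      have : Real.pi / -(-(V / 2)) ≠ 0 := by
        rw [neg_neg]
        positivity
      exact_mod_cast this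
    rw [Complex.cpow_def_of_ne_zero h3]
    exact Complex.exp_ne_zero _
  refine ⟨‖((1 / (2 * Real.pi) : ℝ) : ℂ) * ((Real.pi : ℂ) / -((-(V / 2) : ℝ) : ℂ)) ^ (1 / 2 : ℂ)‖,
    norm_pos_iff.2 (mul_ne_zero (by
      have : 1 / (2 * Real.pi) ≠ 0 := by positivity
      exact_mod_cast this) hbase), fun x r => ?_⟩
  have hint : ∀ u : ℝ, Complex.exp (-(Complex.I * ((u * r : ℝ) : ℂ))) * G.outChar ρ ![u, -x] =
      Complex.exp (((-(V / 2) : ℝ) : ℂ) * u ^ 2 + (W * x + Complex.I * (G.τ 0 - r)) * u +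
        (-(U * x ^ 2 / 2) - Complex.I * (G.τ 1 * x))) := by
    intro u
    rw [GaussianTuple.outChar, charFun_gaussian hσ hf, ← Complex.exp_add, ← Complex.exp_add]
    congr 1
    have hσ' : (σ : ℂ) ≠ 0 := by exact_mod_cast hσ.ne'
    simp only [hVe, hWe, hUe, Matrix.mulVec, dotProduct, Fin.sum_univ_two, Matrix.transpose_apply,
      Matrix.cons_val_zero, Matrix.cons_val_one]
    push_cast
    field_simp
    ring
  simp only [GaussianTuple.act, hint]
  rw [integral_cexp_quadratic (by
    rw [Complex.ofReal_re]
    linarith), ← mul_assoc, norm_mul, Complex.norm_exp]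
  congr 2
  have hV' : (V : ℂ) ≠ 0 := by exact_mod_cast hV.ne'
  have e : (-(U * x ^ 2 / 2) - Complex.I * (G.τ 1 * x)
      - (W * x + Complex.I * (G.τ 0 - r)) ^ 2 / (4 * ((-(V / 2) : ℝ) : ℂ)) : ℂ)
      = ((-((U - W ^ 2 / V) / 2 * x ^ 2) - (r - G.τ 0) ^ 2 / (2 * V) : ℝ) : ℂ)
        + ((-(G.τ 1 * x) + W * x * (G.τ 0 - r) / V : ℝ) : ℂ) * Complex.I := by
    push_cast
    field_simp
    linear_combination 4 * ((r : ℂ) - G.τ 0) ^ 2 * Complex.I_sq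
  rw [e, Complex.add_re, Complex.ofReal_re, Complex.re_ofReal_mul, Complex.I_re, mul_zero, add_zero]

/-- Since `T Ω Tᵀ = (det T) Ω = 0`, complete positivity of a singular channel says that the noise
`N` itself satisfies the uncertainty relation of a quantum state. -/
theorem GaussianTuple.IsSingularChannel.noise {G : GaussianTuple} (hG : G.IsSingularChannel) :
    0 < G.N 0 0 ∧ G.N 1 0 = G.N 0 1 ∧ 1 / 4 ≤ G.N 0 0 * G.N 1 1 - G.N 0 1 ^ 2 := by
  obtain ⟨hcp, hdet⟩ := hG
  unfold GaussianTuple.CompletelyPositive at hcp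
  set M := (G.N.map (fun a : ℝ => (a : ℂ))
    + (Complex.I / 2) • (symp - G.T * symp * G.T.transpose).map (fun a : ℝ => (a : ℂ))) with hM
  rw [Matrix.det_fin_two] at hdet
  have h0 : G.T * symp * G.T.transpose = 0 := by
    ext i j
    fin_cases i <;> fin_cases j <;> simp [symp, Matrix.mul_apply, Fin.sum_univ_two] <;> linarith
  rw [h0, sub_zero] at hM
  have m00 : M 0 0 = (G.N 0 0 : ℂ) := by simp [hM, symp]
  have m01 : M 0 1 = G.N 0 1 + Complex.I / 2 := by simp [hM, symp]
  have m10 : M 1 0 = G.N 1 0 - Complex.I / 2 := by simp [hM, symp, sub_eq_add_neg]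
  have m11 : M 1 1 = (G.N 1 1 : ℂ) := by simp [hM, symp]
  have hsymm : G.N 1 0 = G.N 0 1 := by
    have h := congrArg Complex.re (hcp.1.apply 1 0)
    rw [m01, m10] at h
    simpa using h.symm
  have h00 : 0 ≤ G.N 0 0 := by
    have h := hcp.diag_nonneg (i := 0)
    rw [m00] at h
    exact_mod_cast h
  have hdetM : 1 / 4 ≤ G.N 0 0 * G.N 1 1 - G.N 0 1 ^ 2 := by
    have h := hcp.det_nonneg
    have e : M.det = ((G.N 0 0 * G.N 1 1 - G.N 0 1 ^ 2 - 1 / 4 : ℝ) : ℂ) := by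
      rw [Matrix.det_fin_two, m00, m01, m10, m11, hsymm]
      push_cast
      linear_combination (1 / 4 : ℂ) * Complex.I_sq
    rw [e] at h
    have h' : (0 : ℝ) ≤ G.N 0 0 * G.N 1 1 - G.N 0 1 ^ 2 - 1 / 4 := by exact_mod_cast h
    linarith
  refine ⟨lt_of_le_of_ne h00 fun h => ?_, hsymm, hdetM⟩
  rw [← h] at hdetM
  nlinarith [sq_nonneg (G.N 0 1)]

/-- Adding `T diag (a, b) Tᵀ` to the noise cannot decrease the Schur complement, which for the noise
alone is at least `1 / (4 P)`. -/
theorem schur_complement_ge {P Q n a b x₀ x₁ y₀ y₁ V W U : ℝ} (hP : 0 < P)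
    (hN : 1 / 4 ≤ P * Q - n ^ 2) (ha : 0 ≤ a) (hb : 0 ≤ b)
    (hV : V = a * x₀ ^ 2 + b * x₁ ^ 2 + P) (hW : W = a * (x₀ * y₀) + b * (x₁ * y₁) + n)
    (hU : U = a * y₀ ^ 2 + b * y₁ ^ 2 + Q) : 1 / (4 * P) ≤ U - W ^ 2 / V := by
  have hV0 : 0 < V := by
    rw [hV]
    positivity
  have key : P * (U * V - W ^ 2) = P * (a * b * (x₀ * y₁ - x₁ * y₀) ^ 2)
      + (a * (y₀ * P - x₀ * n) ^ 2 + b * (y₁ * P - x₁ * n) ^ 2) + (P * Q - n ^ 2) * V := by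
    rw [hU, hV, hW]
    ring
  have h1 : 0 ≤ P * (a * b * (x₀ * y₁ - x₁ * y₀) ^ 2) := by positivity
  have h2 : 0 ≤ a * (y₀ * P - x₀ * n) ^ 2 + b * (y₁ * P - x₁ * n) ^ 2 := by positivity
  have h3 : 1 / 4 * V ≤ (P * Q - n ^ 2) * V := by gcongr
  have e : U - W ^ 2 / V = (U * V - W ^ 2) / V := by field_simp
  rw [e, div_le_div_iff₀ (by positivity) hV0]
  linarith

/-- The noise of a singular channel obeys an uncertainty relation on its own, so the output cannot
be sharp in position for one input state and in momentum for another one. -/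
theorem GaussianTuple.not_startsFromIdentity {t₁ : ℝ} (ht₁ : 0 < t₁) {G : ℝ → GaussianTuple}
    (hG : ∀ t ∈ Ioo 0 t₁, (G t).IsSingularChannel) :
    ¬ StartsFromIdentity fun t => (G t).act := by
  intro h
  obtain ⟨ρ₁, hρ₁, hf₁⟩ := exists_gaussian_isState (σ := 1) one_pos 0 0
  obtain ⟨ρ₂, hρ₂, hf₂⟩ := exists_gaussian_isState (σ := 2) two_pos 0 0
  have hnorm {σ : ℝ} (hσ : 0 < σ) {ρ : 𝓢(ℝ × ℝ, ℂ)}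
      (hf : ∀ x r : ℝ, ρ (x, r) = (√(σ / Real.pi) : ℝ) *
        Complex.exp (-σ * (r - (0 : ℝ)) ^ 2 - σ / 4 * x ^ 2 - Complex.I * (0 : ℝ) * x))
      (x r : ℝ) : ‖ρ (x, r)‖ = √(σ / Real.pi) * Real.exp (-(σ * r ^ 2 + σ / 4 * x ^ 2)) := by
    rw [hf, norm_mul, Complex.norm_real, Real.norm_of_nonneg (Real.sqrt_nonneg _),
      Complex.norm_exp]
    congr 2
    have e : (-σ * (r - (0 : ℝ)) ^ 2 - σ / 4 * x ^ 2 - Complex.I * (0 : ℝ) * x : ℂ)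
        = ((-(σ * r ^ 2 + σ / 4 * x ^ 2) : ℝ) : ℂ) := by
      push_cast
      ring
    rw [e, Complex.ofReal_re]
  have hc (σ : ℝ) (hσ : 0 < σ) : √(σ / Real.pi) ≠ 0 := (Real.sqrt_pos.2 (by positivity)).ne'
  have hratio (C a b d : ℝ) (hC : C ≠ 0) :
      C * a * (C * b) / (C * d * (C * d)) = a * b / (d * d) := by
    rw [mul_mul_mul_comm, mul_mul_mul_comm C d, mul_div_mul_left _ _ (mul_ne_zero hC hC)]
  -- half the Schur complement of the output covariance for the first state
  have hlim₁ : Tendsto (fun t => -Real.log (‖(G t).act ρ₁ 1 0‖ / ‖(G t).act ρ₁ 0 0‖))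
      (𝓝[>] 0) (𝓝 (1 / 4)) := by
    have h1 := ((h ρ₁ hρ₁ 1 0).norm.div (h ρ₁ hρ₁ 0 0).norm (by
      rw [hnorm one_pos hf₁]
      exact mul_ne_zero (hc 1 one_pos) (Real.exp_pos _).ne'))
    have e : ‖ρ₁ (1, 0)‖ / ‖ρ₁ (0, 0)‖ = Real.exp (-(1 / 4)) := by
      rw [hnorm one_pos hf₁, hnorm one_pos hf₁]
      rw [mul_div_mul_left _ _ (hc 1 one_pos), ← Real.exp_sub]
      norm_num
    rw [e] at h1
    have h2 := (h1.log (Real.exp_pos _).ne').neg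
    rw [Real.log_exp, neg_neg] at h2
    exact h2
  -- the inverse position variance of the output for the second state
  have hlim₂ : Tendsto (fun t => -Real.log (‖(G t).act ρ₂ 0 1‖ * ‖(G t).act ρ₂ 0 (-1)‖ /
      (‖(G t).act ρ₂ 0 0‖ * ‖(G t).act ρ₂ 0 0‖))) (𝓝[>] 0) (𝓝 4) := by
    have h0 := (h ρ₂ hρ₂ 0 0).norm
    have hne : ‖ρ₂ (0, 0)‖ ≠ 0 := by
      rw [hnorm two_pos hf₂]
      exact mul_ne_zero (hc 2 two_pos) (Real.exp_pos _).ne'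
    have h1 := ((h ρ₂ hρ₂ 0 1).norm.mul (h ρ₂ hρ₂ 0 (-1)).norm).div (h0.mul h0)
      (mul_ne_zero hne hne)
    have e : ‖ρ₂ (0, 1)‖ * ‖ρ₂ (0, -1)‖ / (‖ρ₂ (0, 0)‖ * ‖ρ₂ (0, 0)‖) = Real.exp (-4) := by
      simp only [hnorm two_pos hf₂]
      rw [hratio _ _ _ _ (hc 2 two_pos), ← Real.exp_add, ← Real.exp_add,
        ← Real.exp_sub]
      norm_num
    rw [e] at h1
    have h2 := (h1.log (Real.exp_pos _).ne').neg
    rw [Real.log_exp, neg_neg] at h2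
    exact h2
  have hle : ∀ᶠ t in 𝓝[>] (0 : ℝ),
      1 / 8 * -Real.log (‖(G t).act ρ₂ 0 1‖ * ‖(G t).act ρ₂ 0 (-1)‖ /
        (‖(G t).act ρ₂ 0 0‖ * ‖(G t).act ρ₂ 0 0‖)) ≤
      -Real.log (‖(G t).act ρ₁ 1 0‖ / ‖(G t).act ρ₁ 0 0‖) := by
    filter_upwards [Ioo_mem_nhdsGT ht₁] with t ht
    obtain ⟨hP, hsymm, hunc⟩ := (hG t ht).noise
    obtain ⟨C₁, hC₁, h₁⟩ := (G t).norm_act_gaussian one_pos hf₁ (by positivity) rfl rfl rfl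
    obtain ⟨C₂, hC₂, h₂⟩ := (G t).norm_act_gaussian two_pos hf₂ (by positivity) rfl rfl rfl
    set V₂ := (G t).T 0 0 ^ 2 / (2 * 2) + 2 / 2 * (G t).T 0 1 ^ 2 + (G t).N 0 0 with hV₂
    have hschur := schur_complement_ge (a := 1 / (2 * 1)) (b := 1 / 2) (x₀ := (G t).T 0 0)
      (x₁ := (G t).T 0 1) (y₀ := (G t).T 1 0) (y₁ := (G t).T 1 1)
      (V := (G t).T 0 0 ^ 2 / (2 * 1) + 1 / 2 * (G t).T 0 1 ^ 2 + (G t).N 0 0)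
      (W := (G t).T 0 0 * (G t).T 1 0 / (2 * 1) + 1 / 2 * ((G t).T 0 1 * (G t).T 1 1)
        + ((G t).N 0 1 + (G t).N 1 0) / 2)
      (U := (G t).T 1 0 ^ 2 / (2 * 1) + 1 / 2 * (G t).T 1 1 ^ 2 + (G t).N 1 1)
      hP hunc (by norm_num) (by norm_num) (by ring) (by rw [hsymm]; ring) (by ring)
    set D := (G t).T 1 0 ^ 2 / (2 * 1) + 1 / 2 * (G t).T 1 1 ^ 2 + (G t).N 1 1 -
      ((G t).T 0 0 * (G t).T 1 0 / (2 * 1) + 1 / 2 * ((G t).T 0 1 * (G t).T 1 1)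
        + ((G t).N 0 1 + (G t).N 1 0) / 2) ^ 2 /
      ((G t).T 0 0 ^ 2 / (2 * 1) + 1 / 2 * (G t).T 0 1 ^ 2 + (G t).N 0 0) with hD
    have hV₂P : (G t).N 0 0 ≤ V₂ := by
      rw [hV₂]
      have : 0 ≤ (G t).T 0 0 ^ 2 / (2 * 2) + 2 / 2 * (G t).T 0 1 ^ 2 := by positivity
      linarith
    have hV₂0 : 0 < V₂ := hP.trans_le hV₂P
    have e₁ : Real.log (‖(G t).act ρ₁ 1 0‖ / ‖(G t).act ρ₁ 0 0‖) = -(D / 2) := by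
      rw [h₁, h₁, mul_div_mul_left _ _ hC₁.ne', ← Real.exp_sub, Real.log_exp]
      ring
    have e₂ : Real.log (‖(G t).act ρ₂ 0 1‖ * ‖(G t).act ρ₂ 0 (-1)‖ /
        (‖(G t).act ρ₂ 0 0‖ * ‖(G t).act ρ₂ 0 0‖)) = -(1 / V₂) := by
      simp only [h₂]
      rw [hratio _ _ _ _ hC₂.ne',
        ← Real.exp_add, ← Real.exp_add, ← Real.exp_sub, Real.log_exp]
      field_simp
      ring
    rw [e₁, e₂, neg_neg, neg_neg]
    have h3 : 1 / (4 * V₂) ≤ 1 / (4 * (G t).N 0 0) := by gcongr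
    have h4 : 1 / (4 * V₂) = 1 / 4 * (1 / V₂) := by field_simp
    linarith
  have := le_of_tendsto_of_tendsto (hlim₂.const_mul (1 / 8)) hlim₁ hle
  norm_num at this

/-! ### Master equations -/

/-- If the evolution obeys `∂_t ρ = L_t ρ + κ x ρ` with `κ = i (c' - c A' / A)`, and coherent states
have Gaussian images as in `MasterEquation.eq_generator`, then a master equation exists exactly when
`c` is a constant multiple of `A`, and `L` is its only symmetric generator. -/
theorem masterEquation_characterization {S : Set ℝ} (hS : S.OrdConnected) (hS' : S.Nontrivial)
    {Φ : ℝ → 𝓢(ℝ × ℝ, ℂ) → Kernel} {L : ℝ → QuadGenerator} {c A : ℝ → ℝ}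
    (hc : DifferentiableOn ℝ c S) (hA : DifferentiableOn ℝ A S) (hA0 : ∀ t ∈ S, A t ≠ 0)
    (hL : ∀ t ∈ S, (L t).X.IsSymm ∧ (L t).Z.IsSymm)
    (hΦ : ∀ ρ : 𝓢(ℝ × ℝ, ℂ), ∀ t ∈ S, ∀ x r : ℝ, HasDerivWithinAt (fun s => Φ s ρ x r)
      ((L t).act (Φ t ρ) x r + Complex.I *
        ((derivWithin c S t - c t * derivWithin A S t / A t : ℝ) : ℂ) * x * Φ t ρ x r) S t)
    (hgauss : ∀ t ∈ S, ∃ u v w k₀ a μ ν : ℂ, a ≠ 0 ∧ ν ≠ 0 ∧ ∀ p q : ℝ,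
      ∃ ρ : 𝓢(ℝ × ℝ, ℂ), IsState ρ ∧ ∃ C : ℂ, C ≠ 0 ∧
        Φ t ρ = gaussKernel C u v w (k₀ + a * p + μ * q) (ν * q)) :
    ((∃ g : ℝ → QuadGenerator, MasterEquation S Φ fun t => (g t).act) ↔
        ∃ k : ℝ, ∀ t ∈ S, c t = k * A t) ∧
      ((∃ k : ℝ, ∀ t ∈ S, c t = k * A t) →
        ∀ g : ℝ → QuadGenerator, (∀ t ∈ S, (g t).X.IsSymm ∧ (g t).Z.IsSymm) →
          (MasterEquation S Φ (fun t => (g t).act) ↔ ∀ t ∈ S, g t = L t)) := by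
  have hconv : Convex ℝ S := hS.convex
  have hU : UniqueDiffOn ℝ S :=
    uniqueDiffOn_convex hconv (hconv.nontrivial_iff_nonempty_interior.1 hS')
  have hiff := exists_eq_mul_iff hconv hU hS'.nonempty hc hA hA0
  have hexist (hκ : ∃ k : ℝ, ∀ t ∈ S, c t = k * A t) (g : ℝ → QuadGenerator)
      (hg : ∀ t ∈ S, g t = L t) : MasterEquation S Φ fun t => (g t).act := by
    intro ρ _ t ht x r
    refine (hΦ ρ t ht x r).congr_deriv ?_
    simp [hiff.1 hκ t ht, hg t ht]
  refine ⟨⟨fun ⟨g, hg⟩ => hiff.2 fun t ht => ?_, fun hκ => ⟨L, hexist hκ L fun _ _ => rfl⟩⟩,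
    fun hκ g hgs => ⟨fun hg t ht => ?_, hexist hκ g⟩⟩
  · have := (MasterEquation.eq_generator hU hΦ hgauss hg ht).1
    exact Complex.ofReal_eq_zero.1 ((mul_eq_zero.1 this).resolve_left Complex.I_ne_zero)
  · exact (MasterEquation.eq_generator hU hΦ hgauss hg ht).2 (hgs t ht) (hL t ht)

end GaussChannel

end
theorem mainTheorem5 :
    -- the form `J_I`
    (∀ (S : Set ℝ), S.OrdConnected → S.Nontrivial →
      ∀ J : ℝ → GaussChannel.FormI, GaussChannel.FormI.NonsingularFamily J S →
        ((∃ g : ℝ → GaussChannel.QuadGenerator,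
            GaussChannel.MasterEquation S (fun t => (J t).act) (fun t => (g t).act)) ↔
          ∃ k : ℝ, ∀ t ∈ S, (J t).c = k * (J t).A) ∧
        ((∃ k : ℝ, ∀ t ∈ S, (J t).c = k * (J t).A) →
          ∀ g : ℝ → GaussChannel.QuadGenerator, (∀ t ∈ S, (g t).X.IsSymm ∧ (g t).Z.IsSymm) →
            (GaussChannel.MasterEquation S (fun t => (J t).act) (fun t => (g t).act) ↔
              ∀ t ∈ S, g t = GaussChannel.FormI.generator S J t))) ∧
    -- the form `J_II`
    (∀ (S : Set ℝ), S.OrdConnected → S.Nontrivial →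
      ∀ J : ℝ → GaussChannel.FormII, GaussChannel.FormII.NonsingularFamily J S →
        ((∃ g : ℝ → GaussChannel.QuadGenerator,
            GaussChannel.MasterEquation S (fun t => (J t).act) (fun t => (g t).act)) ↔
          ∃ k : ℝ, ∀ t ∈ S, (J t).c = k * (J t).A) ∧
        ((∃ k : ℝ, ∀ t ∈ S, (J t).c = k * (J t).A) →
          ∀ g : ℝ → GaussChannel.QuadGenerator, (∀ t ∈ S, (g t).X.IsSymm ∧ (g t).Z.IsSymm) →
            (GaussChannel.MasterEquation S (fun t => (J t).act) (fun t => (g t).act) ↔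
              ∀ t ∈ S, g t = GaussChannel.FormII.generator S J t))) ∧
    -- singular channels
    (∀ (t₁ : ℝ), 0 < t₁ → ∀ G : ℝ → GaussChannel.GaussianTuple,
      (∀ t ∈ Set.Ioo 0 t₁, (G t).IsSingularChannel) →
        ¬ ∃ L : ℝ → GaussChannel.Kernel → GaussChannel.Kernel,
          GaussChannel.MasterEquation (Set.Ioo 0 t₁) (fun t => (G t).act) L ∧
            GaussChannel.StartsFromIdentity (fun t => (G t).act)) ∧
    -- singular operations of the form `J_I`
    (∀ (t₁ : ℝ), 0 < t₁ → ∀ J : ℝ → GaussChannel.FormI,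
      (∀ t ∈ Set.Ioo 0 t₁, (J t).TracePreserving ∧ (J t).α * (J t).e₂ = 0) →
        ¬ ∃ L : ℝ → GaussChannel.Kernel → GaussChannel.Kernel,
          GaussChannel.MasterEquation (Set.Ioo 0 t₁) (fun t => (J t).act) L ∧
            GaussChannel.StartsFromIdentity (fun t => (J t).act)) := by
  refine ⟨fun S hS hS' J hJ => ?_, fun S hS hS' J hJ => ?_, fun t₁ ht₁ G hG => ?_,
    fun t₁ ht₁ J hJ => ?_⟩
  · obtain ⟨hA, hc, -⟩ := hJ.differentiableOn
    refine GaussChannel.masterEquation_characterization hS hS' hc hA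
      (fun t ht => (hJ.ne_zero ht).1) (fun t _ => ?_)
      (fun ρ t ht x r => GaussChannel.FormI.hasDerivWithinAt_act hJ ρ ht x r) fun t ht => ?_
    · constructor <;> ext i j <;> fin_cases i <;> fin_cases j <;> rfl
    · obtain ⟨u, v, w, h⟩ := GaussChannel.FormI.act_gaussian (hJ.tracePreserving t ht)
      have hA0 : ((J t).A : ℂ) ≠ 0 := by exact_mod_cast (hJ.ne_zero ht).1
      have he₂0 : ((J t).e₂ : ℂ) ≠ 0 := by exact_mod_cast (hJ.ne_zero ht).2.2
      have he₁ := (hJ.tracePreserving t ht).2.1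
      have hs : 1 / (4 * (1 + (J t).e₂ ^ 2 / (4 * (J t).e₁))) ≠ 0 := by positivity
      exact ⟨u, v, w, _, _, _, _, mul_ne_zero (neg_ne_zero.2 Complex.I_ne_zero) hA0,
        mul_ne_zero (mul_ne_zero (by norm_num) he₂0) (by exact_mod_cast hs), h⟩
  · obtain ⟨hA, hc, -⟩ := hJ.differentiableOn
    refine GaussChannel.masterEquation_characterization hS hS' hc hA
      (fun t ht => (hJ.ne_zero ht).1) (fun t _ => ?_)
      (fun ρ t ht x r => GaussChannel.FormII.hasDerivWithinAt_act hJ ρ ht x r) fun t ht => ?_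
    · constructor <;> ext i j <;> fin_cases i <;> fin_cases j <;> rfl
    · obtain ⟨hA0, hB0, hη⟩ := hJ.ne_zero ht
      obtain ⟨u, v, w, h⟩ := GaussChannel.FormII.act_gaussian (hJ.tracePreserving t ht) hη
      have hA0' : ((J t).A : ℂ) ≠ 0 := by exact_mod_cast hA0
      have hB0' : ((J t).B : ℂ) ≠ 0 := by exact_mod_cast hB0
      exact ⟨u, v, w, _, _, _, _, mul_ne_zero (neg_ne_zero.2 Complex.I_ne_zero) hA0',
        mul_ne_zero two_ne_zero hB0', h⟩
  · exact fun ⟨_, _, h⟩ => GaussChannel.GaussianTuple.not_startsFromIdentity ht₁ hG h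
  · exact fun ⟨_, _, h⟩ => GaussChannel.FormI.not_startsFromIdentity ht₁ hJ h
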